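/- Let $\sigma>1$, $0<\nu<1$, $0<k\le K$ and $C_S,C_\psi>0$. There is a constant $C>0$, depending only on $\sigma,\nu,k,K,C_S,C_\psi$, such that the following holds. Setting. Let $\Omega\subset\mathbb R^n$ be a bounded open set and $d$ a metric on $\Omega$ with balls $B(x,r)=\{y\in\Omega: d(x,y)<r\}$; let $\eta>0$. Let $Q(x)$ be a locally integrable symmetric nonnegative semidefinite matrix on $\Omega$, and write $[\xi]_Q^2=\xi^TQ\xi$. Let $A(x,z)$, $x\in\Omega$, $z\in\mathbb R$, be a symmetric nonnegative semidefinite matrix (such that $x\mapsto A(x,z(x))$ is measurable for measurable $z$) with $$k\,\xi^TQ(x)\xi\le \xi^TA(x,z)\xi\le K\,\xi^TQ(x)\xi\qquad\text{for a.e. }x\in\Omega,\ \text{all } z\in\mathbb R,\ \xi\in\mathbb R^n,$$ and let $f\in L^\infty(\Omega)$. Let $\mathcal W^{1,2}_Q(\Omega)$, respectively $(\mathcal W^{1,2}_Q)_0(\Omega)$, be the set of pairs $(w,\nabla w)$ that are limits of $(w_j,\nabla w_j)$ in $L^2(\Omega)\times\mathcal L^2(\Omega,Q)$, where $\|\mathbf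 g\|^2_{\mathcal L^2(\Omega,Q)}=\int_\Omega[\mathbf g]_Q^2$ and the $w_j$ are Lipschitz on $\Omega$, respectively Lipschitz with compact support in $\Omega$. A pair $(u,\nabla u)\in\mathcal W^{1,2}_Q(\Omega)$ is a weak solution of $\nabla^TA(x,u)\nabla u=f$ in $\Omega$ if $$-\int_\Omega(\nabla u)^TA(x,u)\nabla w=\int_\Omega fw\qquad\text{for all }(w,\nabla w)\in(\mathcal W^{1,2}_Q)_0(\Omega)\text{ with } w\ge0 .$$ Let $\delta_x(r)$ be a non doubling order of the balls: for each $x\in\Omega$ there is $C_x>1$ such that, for all $0<r<\eta\,\mathrm{dist}(x,\partial\Omega)$, $$0<\delta_x(r)\le r,\qquad \tfrac54\le\frac{|B(x,r+\delta_x(r))|}{|B(x,r)|}\le 2C_x .$$ Assume: (1) (containment) for each $x\in\Omega$ there is an increasing function $\alpha_x:(0,\infty)\to(0,\infty)$ such that the Euclidean ball of center $x$ and radius $\alpha_x(r)$ is contained in $B(x,r)$ for all $r>0$; (2) (weak Sobolev inequality) for all $y\in\Omega$, $0<r<\eta\,\mathrm{dist}(y,\partial\Omega)$, $B=B(y,r)$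 and $(w,\nabla w)\in(\mathcal W^{1,2}_Q)_0(B)$, $$\Big\{\frac1{|\mathrm{supp}\,w|}\int_B|w|^{2\sigma}\Big\}^{\frac1{2\sigma}}\le C_S\,r\Big\{\frac1{|\mathrm{supp}\,w|}\int_B[\nabla w]_Q^2\Big\}^{\frac12}+C_S\Big\{\frac1{|\mathrm{supp}\,w|}\int_B|w|^2\Big\}^{\frac12};$$ (3) (accumulating cutoffs) for all $y\in\Omega$ and $0<r<\eta\,\mathrm{dist}(y,\partial\Omega)$ there are Lipschitz functions $\psi_j$, $j\ge1$, with supports $E_j$, such that $E_1\subset B(y,r)$ and, for all $j\ge1$, $\psi_j=1$ on $B(y,\nu r)$, $E_{j+1}$ is compact and contained in $\{\psi_j=1\}$, $|E_j|/|E_{j+1}|\le C_\psi$, and $$\big\|[\nabla\psi_j]_Q\big\|_{L^\infty(B(y,r))}\le\frac{C_\psi}{(1-\nu)\,\delta_y(\nu r)\,\big(1-\delta_y(\nu r)/r\big)^j}.$$ Then every weak solution $u$ is locally bounded in $\Omega$ (essentially bounded on each compact subset of $\Omega$), and for all $y\in\Omega$ and $0<r<\eta\,\mathrm{dist}(y,\partial\Omega)$,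 $$\|u\|_{L^\infty(B(y,\nu r))}\le C(r)\Big\{\Big(\frac1{|B(y,r)|}\int_{B(y,r)}u^2\Big)^{\frac12}+r^2\|f\|_{L^\infty(\Omega)}\Big\},\qquad C(r)=C\Big(\frac{r}{\delta_y(\nu r)}\Big)^{\frac{\sigma}{\sigma-1}} .$$ -/

import Mathlib

open MeasureTheory Filter Topology
open scoped ENNReal

namespace DegenerateEq

/-- Euclidean space `ℝⁿ`. -/
abbrev E (n : ℕ) : Type := EuclideanSpace ℝ (Fin n)

/-- The bilinear form `ξᵀ M ζ`. -/
def form {n : ℕ} (M : Matrix (Fin n) (Fin n) ℝ) (ξ ζ : E n) : ℝ :=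
  ∑ i, ∑ j, ξ i * M i j * ζ j

/-! ### Metric balls -/

/-- `d` is a (symmetric) metric on the set `Ω`. -/
structure IsMetricOn {n : ℕ} (Ω : Set (E n)) (d : E n → E n → ℝ) : Prop where
  eq_zero_iff : ∀ x ∈ Ω, ∀ y ∈ Ω, d x y = 0 ↔ x = y
  symm : ∀ x ∈ Ω, ∀ y ∈ Ω, d x y = d y x
  triangle : ∀ x ∈ Ω, ∀ y ∈ Ω, ∀ z ∈ Ω, d x z ≤ d x y + d y z

/-- The metric ball `B(x,r) = {y ∈ Ω : d(x,y) < r}`. -/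
def mball {n : ℕ} (Ω : Set (E n)) (d : E n → E n → ℝ) (x : E n) (r : ℝ) : Set (E n) :=
  {y | y ∈ Ω ∧ d x y < r}

/-- The radii `0 < r < η dist(x, ∂Ω)`. -/
def IsAdmissibleRadius {n : ℕ} (Ω : Set (E n)) (η : ℝ) (x : E n) (r : ℝ) : Prop :=
  0 < r ∧ r < η * Metric.infDist x (frontier Ω)

/-- Containment condition: around each `x ∈ Ω`, metric balls contain Euclidean balls of radius
`α_x(r)`, with `α_x` positive and increasing. -/
def Containment {n : ℕ} (Ω : Set (E n)) (d : E n → E n → ℝ) : Prop :=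
  ∀ x ∈ Ω, ∃ α : ℝ → ℝ, MonotoneOn α (Set.Ioi 0) ∧ (∀ r, 0 < r → 0 < α r) ∧
    ∀ r, 0 < r → mball Ω d x r ⊆ Ω → Metric.ball x (α r) ⊆ mball Ω d x r

/-- The metric balls are non doubling of order `δ_x(r)` at every `x ∈ Ω`, on the radii
`0 < r < η dist(x, ∂Ω)`: the ball `B(x, r + δ_x(r))` is larger than `B(x,r)` by a factor between
`5/4` and `2C`. Nothing is said on `δ_x(r) / r → 0`, so that doubling balls are allowed. -/
def IsNonDoublingOrder {n : ℕ} (Ω : Set (E n)) (d : E n → E n → ℝ) (η : ℝ)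
    (δ : E n → ℝ → ℝ) : Prop :=
  ∀ x ∈ Ω, ∃ C : ℝ, 1 < C ∧ ∀ r, IsAdmissibleRadius Ω η x r →
    0 < δ x r ∧ δ x r ≤ r ∧
    5 / 4 ≤ volume.real (mball Ω d x (r + δ x r)) / volume.real (mball Ω d x r) ∧
    volume.real (mball Ω d x (r + δ x r)) / volume.real (mball Ω d x r) ≤ 2 * C

/-! ### Degenerate Sobolev spaces -/

/-- `Lip(Ω)`: functions that are Lipschitz on `Ω`. -/
def LipOn {n : ℕ} (Ω : Set (E n)) : Set (E n → ℝ) :=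
  {φ | ∃ L, LipschitzOnWith L φ Ω}

/-- `Lip_c(Ω)`: Lipschitz functions with compact support in `Ω`. -/
def LipC {n : ℕ} (Ω : Set (E n)) : Set (E n → ℝ) :=
  {φ | (∃ L, LipschitzWith L φ) ∧ HasCompactSupport φ ∧ tsupport φ ⊆ Ω}

/-- The squared norm `∫_Ω vᵀ Q v` of `v` in `𝓛²(Ω,Q)`. -/
noncomputable def energy {n : ℕ} (Ω : Set (E n)) (Q : E n → Matrix (Fin n) (Fin n) ℝ)
    (v : E n → E n) : ℝ≥0∞ :=
  ∫⁻ x in Ω, ENNReal.ofReal (form (Q x) (v x) (v x))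

/-- `w ∈ L²(Ω)` and `v ∈ 𝓛²(Ω,Q)` are the limits of `w_k` and of `∇w_k` in these spaces, for a
sequence `w_k` in the class `𝓕` (the gradient of a Lipschitz function exists almost everywhere). -/
structure IsLimitPair {n : ℕ} (𝓕 : Set (E n → ℝ)) (Ω : Set (E n))
    (Q : E n → Matrix (Fin n) (Fin n) ℝ) (w : E n → ℝ) (v : E n → E n) : Prop where
  memLp : MemLp w 2 (volume.restrict Ω)
  aemeasurable : AEMeasurable v (volume.restrict Ω)
  energy_lt_top : energy Ω Q v < ∞
  exists_seq : ∃ wk : ℕ → E n → ℝ, (∀ k, wk k ∈ 𝓕) ∧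
    Tendsto (fun k => eLpNorm (wk k - w) 2 (volume.restrict Ω)) atTop (𝓝 0) ∧
    Tendsto (fun k => energy Ω Q (fun x => gradient (wk k) x - v x)) atTop (𝓝 0)

/-- `(w, ∇w) ∈ 𝓦_Q^{1,2}(Ω)`, with `v` in the role of `∇w`. -/
def MemW {n : ℕ} (Ω : Set (E n)) (Q : E n → Matrix (Fin n) (Fin n) ℝ) (w : E n → ℝ)
    (v : E n → E n) : Prop :=
  IsLimitPair (LipOn Ω) Ω Q w v

/-- `(w, ∇w) ∈ (𝓦_Q^{1,2})₀(Ω)`, with `v` in the role of `∇w`. -/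
def MemWZero {n : ℕ} (Ω : Set (E n)) (Q : E n → Matrix (Fin n) (Fin n) ℝ) (w : E n → ℝ)
    (v : E n → E n) : Prop :=
  IsLimitPair (LipC Ω) Ω Q w v

/-! ### The equation -/

/-- `Q` is locally integrable on `Ω`, with nonnegative semidefinite values. -/
structure IsWeight {n : ℕ} (Ω : Set (E n)) (Q : E n → Matrix (Fin n) (Fin n) ℝ) : Prop where
  locallyIntegrableOn : ∀ i j, LocallyIntegrableOn (fun x => Q x i j) Ω
  posSemidef : ∀ᵐ x ∂(volume.restrict Ω), (Q x).PosSemidef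

/-- `A` is nonnegative semidefinite and `k ξᵀQ(x)ξ ≤ ξᵀA(x,z)ξ ≤ K ξᵀQ(x)ξ`. The measurability
asked for is that `x ↦ A(x, z(x))` is measurable whenever `z` is; it holds when `A` is jointly
measurable, and when `A` is measurable in `x` and continuous in `z`. -/
structure IsStructured {n : ℕ} (Ω : Set (E n)) (Q : E n → Matrix (Fin n) (Fin n) ℝ) (k K : ℝ)
    (A : E n → ℝ → Matrix (Fin n) (Fin n) ℝ) : Prop where
  aemeasurable : ∀ z : E n → ℝ, Measurable z →
    ∀ i j, AEMeasurable (fun x => A x (z x) i j) (volume.restrict Ω)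
  posSemidef : ∀ᵐ x ∂(volume.restrict Ω), ∀ z, (A x z).PosSemidef
  bounds : ∀ᵐ x ∂(volume.restrict Ω), ∀ (z : ℝ) (ξ : E n),
    k * form (Q x) ξ ξ ≤ form (A x z) ξ ξ ∧ form (A x z) ξ ξ ≤ K * form (Q x) ξ ξ

/-- `(u, ∇u) ∈ 𝓦_Q^{1,2}(Ω)`, with `v` in the role of `∇u`, is a weak solution of
`∇ᵀ A(x,u) ∇u = f` in `Ω`. -/
structure IsWeakSolution {n : ℕ} (Ω : Set (E n)) (Q : E n → Matrix (Fin n) (Fin n) ℝ)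
    (A : E n → ℝ → Matrix (Fin n) (Fin n) ℝ) (f u : E n → ℝ) (v : E n → E n) : Prop where
  memW : MemW Ω Q u v
  equation : ∀ (w : E n → ℝ) (g : E n → E n), MemWZero Ω Q w g →
    (∀ᵐ x ∂(volume.restrict Ω), 0 ≤ w x) →
    -∫ x in Ω, form (A x (u x)) (v x) (g x) = ∫ x in Ω, f x * w x

/-! ### The Sobolev inequality and the cutoff functions -/

/-- The support in `B` of the class of `w` modulo null sets: the points of `B` all of whose
neighbourhoods meet `{x ∈ B : w x ≠ 0}` in a set of positive measure. -/
noncomputable def suppIn {n : ℕ} (B : Set (E n)) (w : E n → ℝ) : Set (E n) :=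
  B ∩ (volume.restrict (B ∩ Function.support w)).support

/-- The weak Sobolev inequality with exponent `σ` and constant `C`, on the balls `B(y,r)` with
`y ∈ Ω` and `0 < r < η dist(y, ∂Ω)`; averages are over the support of `w`. -/
def WeakSobolev {n : ℕ} (Ω : Set (E n)) (d : E n → E n → ℝ)
    (Q : E n → Matrix (Fin n) (Fin n) ℝ) (η σ C : ℝ) : Prop :=
  ∀ y ∈ Ω, ∀ r, IsAdmissibleRadius Ω η y r → ∀ (w : E n → ℝ) (v : E n → E n),
    MemWZero (mball Ω d y r) Q w v →
    ((volume (suppIn (mball Ω d y r) w))⁻¹ *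
        ∫⁻ x in mball Ω d y r, ENNReal.ofReal (|w x| ^ (2 * σ))) ^ (1 / (2 * σ)) ≤
      ENNReal.ofReal (C * r) *
        ((volume (suppIn (mball Ω d y r) w))⁻¹ * energy (mball Ω d y r) Q v) ^ (1 / 2 : ℝ) +
      ENNReal.ofReal C *
        ((volume (suppIn (mball Ω d y r) w))⁻¹ *
          ∫⁻ x in mball Ω d y r, ENNReal.ofReal (|w x| ^ 2)) ^ (1 / 2 : ℝ)

/-- `ψ_1, ψ_2, …` is an accumulating sequence of Lipschitz cutoff functions on `B(y,r)` with
parameter `ν` and constant `C`. (The value `ψ 0` plays no role.) -/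
structure IsAccumulating {n : ℕ} (Ω : Set (E n)) (d : E n → E n → ℝ)
    (Q : E n → Matrix (Fin n) (Fin n) ℝ) (δ : E n → ℝ → ℝ) (ν C : ℝ) (y : E n) (r : ℝ)
    (ψ : ℕ → E n → ℝ) : Prop where
  tsupport_subset : tsupport (ψ 1) ⊆ mball Ω d y r
  eq_one : ∀ j, 1 ≤ j → mball Ω d y (ν * r) ⊆ {x | ψ j x = 1}
  isCompact : ∀ j, 1 ≤ j → IsCompact (tsupport (ψ (j + 1)))
  nested : ∀ j, 1 ≤ j → tsupport (ψ (j + 1)) ⊆ {x | ψ j x = 1}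
  measure_ratio : ∀ j, 1 ≤ j →
    volume.real (tsupport (ψ j)) / volume.real (tsupport (ψ (j + 1))) ≤ C
  lipschitz : ∀ j, 1 ≤ j → ∃ L, LipschitzWith L (ψ j)
  gradient_le : ∀ j, 1 ≤ j → ∀ᵐ x ∂(volume.restrict (mball Ω d y r)),
    Real.sqrt (form (Q x) (gradient (ψ j) x) (gradient (ψ j) x)) ≤
      C / ((1 - ν) * δ y (ν * r) * (1 - δ y (ν * r) / r) ^ j)

/-- Each ball `B(y,r)` with `y ∈ Ω` and `0 < r < η dist(y, ∂Ω)` has an accumulating sequence of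
Lipschitz cutoff functions, with the same `ν` and `C`. -/
def HasCutoffs {n : ℕ} (Ω : Set (E n)) (d : E n → E n → ℝ)
    (Q : E n → Matrix (Fin n) (Fin n) ℝ) (δ : E n → ℝ → ℝ) (η ν C : ℝ) : Prop :=
  ∀ y ∈ Ω, ∀ r, IsAdmissibleRadius Ω η y r → ∃ ψ : ℕ → E n → ℝ, IsAccumulating Ω d Q δ ν C y r ψ

end DegenerateEq

open DegenerateEq

/-! The proof is a De Giorgi iteration. Freezing the coefficients, `a x = A x (u x)`, leaves a
linear equation comparable to `Q`; it is stable under `u ↦ -u`, `f ↦ -f`, so an upper bound for `u`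
suffices.

For a level `κ` and a step `Δ`, the test function is `ψ² H(u - κ)`, where `H = trunc Δ` is a `C¹`
substitute for the positive part. Since `(u, ∇u)` is only a limit of Lipschitz pairs, the chain rule
is obtained by passing to the limit, which works because `H'` is continuous and bounded
(`MemW.memWZero_mul_comp`). The result is the energy inequality `IsLinearSolution.caccioppoli`: up
to constants, the energy of `ψ H'(u - κ) ∇u` is at most `(ℓ² + F/Δ) ∫ ((u - κ)⁺)²` over the support
of `ψ`, where `ℓ` bounds `[∇ψ]_Q` and `F` bounds `|f|`.

The Sobolev inequality for `ψ H(u - κ)`, together with Hölder and Chebyshev on `{u > κ + Δ}`, gains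
the power `α = 1 - 1/σ` (`IsLinearSolution.levelMass_step`). The assumed inequality averages over
the support of the function, whose size is not controlled; `WeakSobolev.whole_ball` replaces it by
the whole ball.

Take the levels `M (1 - 2⁻ⁱ)` and the accumulating cutoffs, and let `zᵢ` be the integral of `((u -
κᵢ)⁺)²` over the `i`-th support, divided by `|B| M²`. Because `δ_y(νr) ≤ νr`, the gradient bounds
grow only geometrically, and `zᵢ₊₁ ≤ A₀ (r/δ)² Dⁱ⁺¹ zᵢ^(1+α)`. Hence `zᵢ → 0` as soon as `(r/δ)²
z₀^α` is small (`geometric_decay`), that is, when `M` is at least a constant times `(r/δ)^(1/α)`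
times the quadratic mean of `u`. This is the exponent `1/α = σ/(σ-1)` of the theorem. The condition
`M ≥ r² F` makes the source term harmless. -/

namespace DegenerateEq

/-! ### The form of a matrix -/

section Form

variable {n : ℕ} {M : Matrix (Fin n) (Fin n) ℝ}

lemma form_add_left (a b c : E n) : form M (a + b) c = form M a c + form M b c := by
  simp only [form, PiLp.add_apply, add_mul, Finset.sum_add_distrib]

lemma form_add_right (a b c : E n) : form M a (b + c) = form M a b + form M a c := by
  simp only [form, PiLp.add_apply, mul_add, Finset.sum_add_distrib]

lemma form_smul_left (t : ℝ) (a b : E n) : form M (t • a) b = t * form M a b := by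
  simp only [form, PiLp.smul_apply, smul_eq_mul, Finset.mul_sum, mul_assoc]

lemma form_smul_right (t : ℝ) (a b : E n) : form M a (t • b) = t * form M a b := by
  simp only [form, PiLp.smul_apply, smul_eq_mul, Finset.mul_sum]
  exact Finset.sum_congr rfl fun i _ => Finset.sum_congr rfl fun j _ => by ring

lemma form_neg_left (a b : E n) : form M (-a) b = -form M a b := by
  simpa using form_smul_left (M := M) (-1) a b

lemma form_neg_right (a b : E n) : form M a (-b) = -form M a b := by
  simpa using form_smul_right (M := M) (-1) a b

@[simp] lemma form_zero_left (b : E n) : form M 0 b = 0 := by simp [form]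

@[simp] lemma form_zero_right (b : E n) : form M b 0 = 0 := by simp [form]

lemma form_smul_self (t : ℝ) (a : E n) : form M (t • a) (t • a) = t ^ 2 * form M a a := by
  rw [form_smul_left, form_smul_right]; ring

lemma form_neg_self (a : E n) : form M (-a) (-a) = form M a a := by
  rw [form_neg_left, form_neg_right, neg_neg]

lemma form_comm (hM : M.PosSemidef) (a b : E n) : form M a b = form M b a := by
  unfold form
  rw [Finset.sum_comm]
  refine Finset.sum_congr rfl fun i _ => Finset.sum_congr rfl fun j _ => ?_
  have := hM.1.apply i j
  simp only [star_trivial] at this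
  rw [this]; ring

lemma form_self_nonneg (hM : M.PosSemidef) (a : E n) : 0 ≤ form M a a := by
  have := hM.dotProduct_mulVec_nonneg (fun i => a i)
  simpa [form, dotProduct, Matrix.mulVec, Finset.mul_sum, mul_assoc] using this

lemma form_add_self (hM : M.PosSemidef) (a b : E n) :
    form M (a + b) (a + b) = form M a a + 2 * form M a b + form M b b := by
  rw [form_add_left, form_add_right, form_add_right, form_comm hM b a]; ring

lemma form_add_smul_self_nonneg (hM : M.PosSemidef) (t : ℝ) (a b : E n) :
    0 ≤ form M a a + 2 * t * form M a b + t ^ 2 * form M b b := by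
  have := form_self_nonneg hM (a + t • b)
  rw [form_add_self hM, form_smul_right, form_smul_self] at this
  linarith

lemma form_add_self_le (hM : M.PosSemidef) (a b : E n) :
    form M (a + b) (a + b) ≤ 2 * form M a a + 2 * form M b b := by
  have := form_add_smul_self_nonneg hM (-1) a b
  rw [form_add_self hM]; linarith

/-- Used to dominate mixed terms by two energy densities, which makes them integrable. -/
lemma abs_form_le (hM : M.PosSemidef) (a b : E n) :
    |form M a b| ≤ form M a a + form M b b := by
  have h1 := form_add_smul_self_nonneg hM (-1) a b
  have h2 := form_add_smul_self_nonneg hM 1 a b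
  have h3 := form_self_nonneg hM a
  have h4 := form_self_nonneg hM b
  rw [abs_le]; constructor <;> linarith

/-- The Cauchy-Schwarz inequality. -/
lemma form_sq_le (hM : M.PosSemidef) (a b : E n) :
    form M a b ^ 2 ≤ form M a a * form M b b := by
  have h := discrim_le_zero (a := form M b b) (b := 2 * form M a b) (c := form M a a)
    fun t => by linarith [form_add_smul_self_nonneg hM t a b]
  rw [discrim] at h
  linarith

lemma aemeasurable_form {μ : Measure (E n)} {M : E n → Matrix (Fin n) (Fin n) ℝ}
    {a b : E n → E n} (hM : ∀ i j, AEMeasurable (fun x => M x i j) μ)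
    (ha : AEMeasurable a μ) (hb : AEMeasurable b μ) :
    AEMeasurable (fun x => form (M x) (a x) (b x)) μ := by
  unfold form
  refine Finset.aemeasurable_fun_sum _ fun i _ => Finset.aemeasurable_fun_sum _ fun j _ => ?_
  have hi : AEMeasurable (fun x => a x i) μ :=
    (EuclideanSpace.proj (𝕜 := ℝ) i).continuous.measurable.comp_aemeasurable ha
  have hj : AEMeasurable (fun x => b x j) μ :=
    (EuclideanSpace.proj (𝕜 := ℝ) j).continuous.measurable.comp_aemeasurable hb
  exact (hi.mul (hM i j)).mul hj

lemma IsWeight.aemeasurable {Ω : Set (E n)} {Q : E n → Matrix (Fin n) (Fin n) ℝ}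
    (hQ : IsWeight Ω Q) (i j : Fin n) :
    AEMeasurable (fun x => Q x i j) (volume.restrict Ω) :=
  ((hQ.locallyIntegrableOn i j).aestronglyMeasurable).aemeasurable

end Form

/-! ### Gradients of Lipschitz functions -/

section Gradient

variable {n : ℕ}

lemma measurable_gradient (f : E n → ℝ) : Measurable (gradient f) :=
  ((InnerProductSpace.toDual ℝ (E n)).symm.continuous.measurable).comp (measurable_fderiv ℝ f)

lemma gradient_eq_zero_of_notMem_tsupport {f : E n → ℝ} {x : E n} (hx : x ∉ tsupport f) :
    gradient f x = 0 := by
  have h : fderiv ℝ f x = 0 := by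
    by_contra h
    exact hx (support_fderiv_subset ℝ h)
  rw [gradient, h, map_zero]

lemma gradient_eq_of_hasFDerivAt {f : E n → ℝ} {f' : E n →L[ℝ] ℝ} {x : E n}
    (h : HasFDerivAt f f' x) : gradient f x = (InnerProductSpace.toDual ℝ (E n)).symm f' := by
  rw [gradient, h.fderiv]

lemma gradient_mul_comp {φ w : E n → ℝ} {G : ℝ → ℝ} {G' : ℝ} {x : E n}
    (hφ : DifferentiableAt ℝ φ x) (hw : DifferentiableAt ℝ w x) (hG : HasDerivAt G G' (w x)) :
    gradient (fun y => φ y * G (w y)) x =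
      G (w x) • gradient φ x + (φ x * G') • gradient w x := by
  have h1 : HasFDerivAt (fun y => G (w y)) (G' • fderiv ℝ w x) x :=
    hG.comp_hasFDerivAt x hw.hasFDerivAt
  have h2 : HasFDerivAt (fun y => φ y * G (w y)) _ x := hφ.hasFDerivAt.mul h1
  rw [gradient_eq_of_hasFDerivAt h2, gradient, gradient, map_add, map_smul, map_smul, map_smul, smul_smul, add_comm]

lemma gradient_add {f g : E n → ℝ} {x : E n} (hf : DifferentiableAt ℝ f x)
    (hg : DifferentiableAt ℝ g x) :
    gradient (fun y => f y + g y) x = gradient f x + gradient g x := by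
  have h : HasFDerivAt (fun y => f y + g y) _ x := hf.hasFDerivAt.add hg.hasFDerivAt
  rw [gradient_eq_of_hasFDerivAt h, map_add]; rfl

lemma gradient_const_mul {f : E n → ℝ} {x : E n} (hf : DifferentiableAt ℝ f x) (t : ℝ) :
    gradient (fun y => t * f y) x = t • gradient f x := by
  rw [gradient_eq_of_hasFDerivAt (hf.hasFDerivAt.const_mul t), map_smul]; rfl

lemma gradient_sq {f : E n → ℝ} {x : E n} (hf : DifferentiableAt ℝ f x) :
    gradient (fun y => f y ^ 2) x = (2 * f x) • gradient f x := by
  have h := (hasDerivAt_pow 2 (f x)).comp_hasFDerivAt x hf.hasFDerivAt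
  rw [show (fun y => f y ^ 2) = (fun z : ℝ => z ^ 2) ∘ f from rfl,
    gradient_eq_of_hasFDerivAt h, map_smul]
  simp [gradient]

lemma norm_gradient_le {f : E n → ℝ} {L : NNReal} (hf : LipschitzWith L f) (x : E n) :
    ‖gradient f x‖ ≤ L := by
  rw [gradient, LinearIsometryEquiv.norm_map]
  exact norm_fderiv_le_of_lipschitz ℝ hf

/-- The truncation to `[0, 1]`. -/
def clamp (t : ℝ) : ℝ := max 0 (min 1 t)

lemma clamp_nonneg (t : ℝ) : 0 ≤ clamp t := le_max_left _ _

lemma clamp_le_one (t : ℝ) : clamp t ≤ 1 := max_le zero_le_one (min_le_left _ _)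

@[simp] lemma clamp_zero : clamp 0 = 0 := by simp [clamp]

@[simp] lemma clamp_one : clamp 1 = 1 := by simp [clamp]

lemma lipschitzWith_clamp : LipschitzWith 1 clamp :=
  (LipschitzWith.id.const_min 1).const_max 0

/-- Where `f` lies strictly between 0 and 1 truncation changes nothing nearby; elsewhere the
truncated function attains its global maximum or minimum, so its derivative vanishes. Truncating a
cutoff function therefore never increases its gradient. -/
lemma gradient_clamp {f : E n → ℝ} {x : E n}
    (hf : DifferentiableAt ℝ f x) :
    gradient (fun y => clamp (f y)) x = 0 ∨ gradient (fun y => clamp (f y)) x = gradient f x := by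
  by_cases h0 : 0 < f x
  · by_cases h1 : f x < 1
    · right
      have : (fun y => clamp (f y)) =ᶠ[𝓝 x] f := by
        filter_upwards [hf.continuousAt.eventually (lt_mem_nhds h0),
          hf.continuousAt.eventually (gt_mem_nhds h1)] with y hy0 hy1
        simp only [clamp]
        rw [min_eq_right hy1.le, max_eq_right hy0.le]
      rw [gradient, this.fderiv_eq, gradient]
    · left
      have : IsLocalMax (fun y => clamp (f y)) x := by
        refine Eventually.of_forall fun y => ?_
        have : clamp (f x) = 1 := by
          simp only [clamp]; rw [min_eq_left (not_lt.1 h1), max_eq_right zero_le_one]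
        exact (clamp_le_one _).trans this.ge
      rw [gradient, this.fderiv_eq_zero, map_zero]
  · left
    have : IsLocalMin (fun y => clamp (f y)) x := by
      refine Eventually.of_forall fun y => ?_
      have : clamp (f x) = 0 := by
        simp only [clamp]; exact max_eq_left ((min_le_right _ _).trans (not_lt.1 h0))
      exact this.le.trans (clamp_nonneg _)
    rw [gradient, this.fderiv_eq_zero, map_zero]

end Gradient

/-! ### Lipschitz functions of compact support -/

section LipC

variable {n : ℕ}

lemma exists_lipschitzWith_mul {φ g : E n → ℝ} {L L' : NNReal} (hφ : LipschitzWith L φ)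
    (hc : HasCompactSupport φ) (hg : LipschitzWith L' g) :
    ∃ L'', LipschitzWith L'' fun x => φ x * g x := by
  obtain ⟨a, ha⟩ := hφ.continuous.bounded_above_of_compact_support hc
  obtain ⟨b, hb⟩ := hc.isCompact.exists_bound_of_continuousOn hg.continuous.continuousOn
  -- Splitting the difference so that `g` is evaluated only at `x` requires just one of the two
  -- points in the support; `g` itself may be unbounded.
  have key : ∀ x ∈ tsupport φ, ∀ y, |φ x * g x - φ y * g y| ≤ (L * |b| + |a| * L') * dist x y := by
    intro x hx y
    have h1 : |φ x - φ y| ≤ L * dist x y := by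
      simpa [Real.dist_eq] using hφ.dist_le_mul x y
    have h2 : |g x - g y| ≤ L' * dist x y := by
      simpa [Real.dist_eq] using hg.dist_le_mul x y
    have h3 : |φ y| ≤ |a| := (ha y).trans (le_abs_self a)
    have h4 : |g x| ≤ |b| := (hb x hx).trans (le_abs_self b)
    calc |φ x * g x - φ y * g y| = |(φ x - φ y) * g x + φ y * (g x - g y)| := by congr 1; ring
      _ ≤ |φ x - φ y| * |g x| + |φ y| * |g x - g y| := by
        rw [← abs_mul, ← abs_mul]; exact abs_add_le _ _
      _ ≤ L * dist x y * |b| + |a| * (L' * dist x y) := by gcongr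
      _ = _ := by ring
  refine ⟨⟨L * |b| + |a| * L', by positivity⟩, LipschitzWith.of_dist_le_mul fun x y => ?_⟩
  rw [Real.dist_eq]
  change _ ≤ (L * |b| + |a| * L') * dist x y
  by_cases hx : x ∈ tsupport φ
  · exact key x hx y
  by_cases hy : y ∈ tsupport φ
  · rw [abs_sub_comm, dist_comm]; exact key y hy x
  rw [image_eq_zero_of_notMem_tsupport hx, image_eq_zero_of_notMem_tsupport hy]
  simp only [zero_mul, sub_self, abs_zero]
  positivity

/-- The extension of a function that is Lipschitz on an open set agrees with it near the points of
the set. -/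
lemma LipOn.exists_extension {Ω : Set (E n)} (hΩ : IsOpen Ω) {w : E n → ℝ} (hw : w ∈ LipOn Ω) :
    ∃ (w' : E n → ℝ) (L : NNReal), LipschitzWith L w' ∧ Set.EqOn w w' Ω ∧
      ∀ x ∈ Ω, w =ᶠ[𝓝 x] w' := by
  obtain ⟨L, hL⟩ := hw
  obtain ⟨w', h1, h2⟩ := hL.extend_real
  refine ⟨w', L, h1, h2, fun x hx => ?_⟩
  filter_upwards [hΩ.mem_nhds hx] with y hy using h2 hy

lemma LipOn.ae_differentiableAt {Ω : Set (E n)} (hΩ : IsOpen Ω) {w : E n → ℝ} (hw : w ∈ LipOn Ω) :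
    ∀ᵐ x ∂(volume.restrict Ω), DifferentiableAt ℝ w x := by
  obtain ⟨w', L, h1, -, h2⟩ := LipOn.exists_extension hΩ hw
  filter_upwards [ae_restrict_mem hΩ.measurableSet, ae_restrict_of_ae h1.ae_differentiableAt]
    with x hx hd
  exact hd.congr_of_eventuallyEq (h2 x hx)

lemma mul_comp_mem_LipC {Ω U : Set (E n)} (hΩ : IsOpen Ω) (hU : U ⊆ Ω) {φ w : E n → ℝ} {G : ℝ → ℝ}
    {L c : NNReal} (hφ : LipschitzWith L φ) (hc : HasCompactSupport φ) (hs : tsupport φ ⊆ U)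
    (hw : w ∈ LipOn Ω) (hG : LipschitzWith c G) : (fun x => φ x * G (w x)) ∈ LipC U := by
  obtain ⟨w', L', h1, h2, -⟩ := LipOn.exists_extension hΩ hw
  -- Nothing is known about `w` outside `Ω`, but there the cutoff vanishes, so the product is
  -- unchanged by a global Lipschitz extension.
  have e : (fun x => φ x * G (w x)) = fun x => φ x * G (w' x) := by
    funext x
    by_cases hx : x ∈ tsupport φ
    · rw [h2 (hU (hs hx))]
    · rw [image_eq_zero_of_notMem_tsupport hx, zero_mul, zero_mul]
  refine ⟨?_, hc.mul_right, (tsupport_mul_subset_left).trans hs⟩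
  rw [e]
  exact exists_lipschitzWith_mul hφ hc (hG.comp h1)

end LipC

/-! ### The chain rule -/

section Chain

variable {n : ℕ} {Ω U : Set (E n)} {Q : E n → Matrix (Fin n) (Fin n) ℝ}

lemma energy_mono_set (h : U ⊆ Ω) (v : E n → E n) : energy U Q v ≤ energy Ω Q v :=
  lintegral_mono_set h

lemma aemeasurable_energy_density (hQ : IsWeight Ω Q) {v : E n → E n}
    (hv : AEMeasurable v (volume.restrict Ω)) :
    AEMeasurable (fun x => ENNReal.ofReal (form (Q x) (v x) (v x))) (volume.restrict Ω) :=
  (aemeasurable_form hQ.aemeasurable hv hv).ennreal_ofReal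

/-- Convergence in `L²` implies convergence in measure, hence almost everywhere along a subsequence.
Pointwise convergence is what lets continuity of `G'` be used in the chain rule. -/
lemma exists_seq_ae_tendsto {𝓕 : Set (E n → ℝ)} {u : E n → ℝ} {v : E n → E n}
    (h𝓕 : ∀ w ∈ 𝓕, AEStronglyMeasurable w (volume.restrict Ω)) (h : IsLimitPair 𝓕 Ω Q u v) :
    ∃ wk : ℕ → E n → ℝ, (∀ k, wk k ∈ 𝓕) ∧
      Tendsto (fun k => eLpNorm (wk k - u) 2 (volume.restrict Ω)) atTop (𝓝 0) ∧
      Tendsto (fun k => energy Ω Q (fun x => gradient (wk k) x - v x)) atTop (𝓝 0) ∧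
      ∀ᵐ x ∂(volume.restrict Ω), Tendsto (fun k => wk k x) atTop (𝓝 (u x)) := by
  obtain ⟨wk, h1, h2, h3⟩ := h.exists_seq
  have h4 : TendstoInMeasure (volume.restrict Ω) wk atTop u :=
    tendstoInMeasure_of_tendsto_eLpNorm two_ne_zero (fun k => h𝓕 _ (h1 k)) h.memLp.1 h2
  obtain ⟨ns, h5, h6⟩ := h4.exists_seq_tendsto_ae
  exact ⟨fun k => wk (ns k), fun k => h1 _, h2.comp h5.tendsto_atTop, h3.comp h5.tendsto_atTop, h6⟩

lemma LipOn.aestronglyMeasurable (hΩ : IsOpen Ω) {w : E n → ℝ} (hw : w ∈ LipOn Ω) :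
    AEStronglyMeasurable w (volume.restrict Ω) := by
  obtain ⟨L, hL⟩ := hw
  exact hL.continuousOn.aestronglyMeasurable hΩ.measurableSet

lemma lintegral_sq_eq_eLpNorm_sq {μ : Measure (E n)} (g : E n → ℝ) :
    ∫⁻ x, ENNReal.ofReal (g x ^ 2) ∂μ = eLpNorm g 2 μ ^ 2 := by
  rw [← ENNReal.rpow_natCast, eLpNorm_eq_lintegral_rpow_enorm_toReal two_ne_zero ENNReal.ofNat_ne_top,
    ← ENNReal.rpow_mul]
  simp only [ENNReal.toReal_ofNat, Nat.cast_ofNat, one_div, isUnit_iff_ne_zero, ne_eq,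
    OfNat.ofNat_ne_zero, not_false_eq_true, IsUnit.inv_mul_cancel, ENNReal.rpow_one]
  refine lintegral_congr fun x => ?_
  rw [Real.enorm_eq_ofReal_abs, ← sq_abs, ENNReal.ofReal_pow (abs_nonneg _)]
  norm_cast

lemma energy_lt_top_of_le {v : E n → E n} {g : E n → ℝ} (hg : MemLp g 2 (volume.restrict Ω))
    (h : ∀ᵐ x ∂(volume.restrict Ω), form (Q x) (v x) (v x) ≤ g x ^ 2) : energy Ω Q v < ∞ := by
  calc energy Ω Q v ≤ ∫⁻ x in Ω, ENNReal.ofReal (g x ^ 2) :=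
        lintegral_mono_ae (h.mono fun x hx => ENNReal.ofReal_le_ofReal hx)
    _ = eLpNorm g 2 (volume.restrict Ω) ^ 2 := lintegral_sq_eq_eLpNorm_sq g
    _ < ∞ := ENNReal.pow_lt_top hg.2

lemma energy_mul_le {v : E n → E n} {a : E n → ℝ} {c : ℝ} (hQ : IsWeight Ω Q)
    (ha : ∀ x, a x ^ 2 ≤ c) :
    energy Ω Q (fun x => a x • v x) ≤ ENNReal.ofReal c * energy Ω Q v := by
  have hc : 0 ≤ c := (sq_nonneg _).trans (ha 0)
  rw [energy, energy, ← lintegral_const_mul' _ _ ENNReal.ofReal_ne_top]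
  refine lintegral_mono_ae (hQ.posSemidef.mono fun x hx => ?_)
  rw [form_smul_self, ← ENNReal.ofReal_mul hc]
  exact ENNReal.ofReal_le_ofReal (mul_le_mul_of_nonneg_right (ha x) (form_self_nonneg hx _))

lemma energy_add_le {a b : E n → E n} (hQ : IsWeight Ω Q)
    (ha : AEMeasurable a (volume.restrict Ω)) :
    energy Ω Q (fun x => a x + b x) ≤ 2 * energy Ω Q a + 2 * energy Ω Q b := by
  rw [energy, energy, energy, ← lintegral_const_mul' _ _ (by simp),
    ← lintegral_const_mul' _ _ (by simp),
    ← lintegral_add_left' ((aemeasurable_energy_density hQ ha).const_mul _)]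
  refine lintegral_mono_ae (hQ.posSemidef.mono fun x hx => ?_)
  have h2 : ∀ t : ℝ, (2 : ℝ≥0∞) * ENNReal.ofReal t = ENNReal.ofReal (2 * t) := fun t => by
    rw [ENNReal.ofReal_mul zero_le_two, ENNReal.ofReal_ofNat]
  rw [h2, h2, ← ENNReal.ofReal_add (mul_nonneg zero_le_two (form_self_nonneg hx _))
      (mul_nonneg zero_le_two (form_self_nonneg hx _))]
  exact ENNReal.ofReal_le_ofReal (form_add_self_le hx _ _)

lemma lipschitzWith_of_abs_deriv_le {G G' : ℝ → ℝ} {c : ℝ} (hG : ∀ t, HasDerivAt G (G' t) t)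
    (hc : ∀ t, |G' t| ≤ c) : LipschitzWith c.toNNReal G :=
  lipschitzWith_of_nnnorm_deriv_le (fun t => (hG t).differentiableAt) fun t => by
    rw [(hG t).deriv, ← norm_toNNReal]
    exact Real.toNNReal_le_toNNReal (hc t)

lemma abs_sub_le_of_abs_deriv_le {G G' : ℝ → ℝ} {c : ℝ} (hG : ∀ t, HasDerivAt G (G' t) t)
    (hc : ∀ t, |G' t| ≤ c) (s t : ℝ) : |G s - G t| ≤ c * |s - t| := by
  have h := (lipschitzWith_of_abs_deriv_le hG hc).dist_le_mul s t
  rwa [Real.dist_eq, Real.dist_eq, Real.coe_toNNReal _ ((abs_nonneg _).trans (hc 0))] at h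

lemma memLp_comp_of_abs_deriv_le {μ : Measure (E n)} [IsFiniteMeasure μ] {u : E n → ℝ}
    (hu : MemLp u 2 μ) {G G' : ℝ → ℝ} {c : ℝ} (hG : ∀ t, HasDerivAt G (G' t) t)
    (hc : ∀ t, |G' t| ≤ c) : MemLp (fun x => G (u x)) 2 μ := by
  have hGc : Continuous G := (lipschitzWith_of_abs_deriv_le hG hc).continuous
  have h1 : MemLp (fun x => G (u x) - G 0) 2 μ := by
    refine MemLp.of_le_mul (c := c) hu ((hGc.measurable.comp_aemeasurable
      hu.1.aemeasurable).sub_const _).aestronglyMeasurable (Eventually.of_forall fun x => ?_)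
    simpa using abs_sub_le_of_abs_deriv_le hG hc (u x) 0
  have h2 : MemLp (fun x => (G (u x) - G 0) + G 0) 2 μ := MemLp.add h1 (memLp_const (G 0))
  simpa using h2

set_option maxHeartbeats 800000 in
/-- Products `φ G(u)` with a Lipschitz cutoff function `φ` and a `C¹` function `G` of bounded
derivative belong to the space with zero boundary values, with the expected gradient. -/
lemma MemW.memWZero_mul_comp (hΩ : IsOpen Ω) (hb : Bornology.IsBounded Ω) (hU : U ⊆ Ω)
    (hQ : IsWeight Ω Q) {u : E n → ℝ} {v : E n → E n} (huv : MemW Ω Q u v)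
    {φ : E n → ℝ} {G G' : ℝ → ℝ} {L : NNReal} {c ℓ : ℝ} (hφ : LipschitzWith L φ)
    (hs : tsupport φ ⊆ U)
    (hℓ : ∀ᵐ x ∂(volume.restrict Ω), form (Q x) (gradient φ x) (gradient φ x) ≤ ℓ ^ 2)
    (hG : ∀ t, HasDerivAt G (G' t) t) (hG' : Continuous G') (hc : ∀ t, |G' t| ≤ c) :
    MemWZero U Q (fun x => φ x * G (u x))
      (fun x => G (u x) • gradient φ x + (φ x * G' (u x)) • v x) := by
  have hc0 : 0 ≤ c := (abs_nonneg _).trans (hc 0)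
  have hGL := lipschitzWith_of_abs_deriv_le hG hc
  have hGd := abs_sub_le_of_abs_deriv_le hG hc
  have hGc : Continuous G := hGL.continuous
  have hK : HasCompactSupport φ :=
    Metric.isCompact_of_isClosed_isBounded (isClosed_tsupport φ) (hb.subset (hs.trans hU))
  obtain ⟨b, hbφ⟩ := hφ.continuous.bounded_above_of_compact_support hK
  have hb0 : 0 ≤ b := (norm_nonneg _).trans (hbφ 0)
  have hfin : IsFiniteMeasure (volume.restrict Ω) := ⟨by
    rw [Measure.restrict_apply_univ]; exact hb.measure_lt_top⟩
  have hu : AEMeasurable u (volume.restrict Ω) := huv.memLp.1.aemeasurable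
  have hGu : AEMeasurable (fun x => G (u x)) (volume.restrict Ω) :=
    hGc.measurable.comp_aemeasurable hu
  have hG'u : AEMeasurable (fun x => G' (u x)) (volume.restrict Ω) :=
    hG'.measurable.comp_aemeasurable hu
  have hφm : Measurable φ := hφ.continuous.measurable
  have hgm := measurable_gradient φ
  have hGLp : MemLp (fun x => G (u x)) 2 (volume.restrict Ω) :=
    memLp_comp_of_abs_deriv_le huv.memLp hG hc
  have hmem : MemLp (fun x => φ x * G (u x)) 2 (volume.restrict Ω) := by
    refine (hGLp.const_mul b).of_le (hφm.aemeasurable.mul hGu).aestronglyMeasurable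
      (Eventually.of_forall fun x => ?_)
    rw [norm_mul, norm_mul, Real.norm_of_nonneg hb0]
    exact mul_le_mul_of_nonneg_right (hbφ x) (norm_nonneg _)
  have ham : AEMeasurable (fun x => G (u x) • gradient φ x) (volume.restrict Ω) :=
    hGu.smul hgm.aemeasurable
  have hbm : AEMeasurable (fun x => (φ x * G' (u x)) • v x) (volume.restrict Ω) :=
    (hφm.aemeasurable.mul hG'u).smul huv.aemeasurable
  have hcoef : ∀ x t, (φ x * G' t) ^ 2 ≤ b ^ 2 * c ^ 2 := fun x t => by
    rw [mul_pow, ← sq_abs (φ x), ← sq_abs (G' t)]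
    gcongr
    · exact hbφ x
    · exact hc t
  have hres : volume.restrict U ≤ volume.restrict Ω := Measure.restrict_mono hU le_rfl
  refine ⟨hmem.mono_measure hres, (ham.add hbm).mono_measure hres, ?_, ?_⟩
  · refine (energy_mono_set hU _).trans_lt ((energy_add_le hQ ham).trans_lt ?_)
    refine ENNReal.add_lt_top.2 ⟨ENNReal.mul_lt_top (by simp) ?_, ENNReal.mul_lt_top (by simp) ?_⟩
    · refine energy_lt_top_of_le (hGLp.const_mul ℓ) (hℓ.mono fun x hx => ?_)
      rw [form_smul_self, mul_pow, mul_comm]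
      exact mul_le_mul_of_nonneg_right hx (sq_nonneg _)
    · exact (energy_mul_le hQ fun x => hcoef x (u x)).trans_lt
        (ENNReal.mul_lt_top ENNReal.ofReal_lt_top huv.energy_lt_top)
  obtain ⟨wk, h1, h2, h3, h4⟩ :=
    exists_seq_ae_tendsto (fun w hw => LipOn.aestronglyMeasurable hΩ hw) huv
  have hwm : ∀ k, AEMeasurable (wk k) (volume.restrict Ω) := fun k =>
    (LipOn.aestronglyMeasurable hΩ (h1 k)).aemeasurable
  refine ⟨fun k x => φ x * G (wk k x), fun k => mul_comp_mem_LipC hΩ hU hφ hK hs (h1 k) hGL, ?_, ?_⟩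
  · have hle : ∀ k, eLpNorm ((fun x => φ x * G (wk k x)) - fun x => φ x * G (u x)) 2
        (volume.restrict U) ≤ ENNReal.ofReal (b * c) * eLpNorm (wk k - u) 2 (volume.restrict Ω) := by
      intro k
      refine (eLpNorm_mono_measure _ hres).trans ?_
      refine eLpNorm_le_mul_eLpNorm_of_ae_le_mul (Eventually.of_forall fun x => ?_) 2
      simp only [Pi.sub_apply, Real.norm_eq_abs]
      rw [← mul_sub, abs_mul, mul_assoc]
      exact mul_le_mul (hbφ x) (hGd _ _) (abs_nonneg _) hb0
    refine tendsto_of_tendsto_of_tendsto_of_le_of_le tendsto_const_nhds ?_ (fun _ => zero_le) hle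
    simpa using ENNReal.Tendsto.const_mul h2 (Or.inr ENNReal.ofReal_ne_top)
  -- The gradient error splits into `(G(w_k) - G(u)) ∇φ`, controlled by the Lipschitz bound on `G`;
  -- `φ G'(w_k) (∇w_k - v)`, controlled by the bound on `G'`; and `φ (G'(w_k) - G'(u)) v`, which
  -- tends to 0 by dominated convergence.
  · set T1 : ℕ → ℝ≥0∞ := fun k => ENNReal.ofReal (ℓ ^ 2 * c ^ 2) *
      eLpNorm (wk k - u) 2 (volume.restrict Ω) ^ 2 with hT1
    set T2 : ℕ → ℝ≥0∞ := fun k => ENNReal.ofReal (b ^ 2 * c ^ 2) *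
      energy Ω Q (fun x => gradient (wk k) x - v x) with hT2
    set T3 : ℕ → ℝ≥0∞ := fun k =>
      energy Ω Q (fun x => (φ x * (G' (wk k x) - G' (u x))) • v x) with hT3
    have hle : ∀ k, energy U Q (fun x => gradient (fun x => φ x * G (wk k x)) x -
        (G (u x) • gradient φ x + (φ x * G' (u x)) • v x)) ≤
        2 * (2 * T1 k + 2 * T2 k) + 2 * T3 k := by
      intro k
      refine (energy_mono_set hU _).trans ?_
      have e : energy Ω Q (fun x => gradient (fun x => φ x * G (wk k x)) x -
          (G (u x) • gradient φ x + (φ x * G' (u x)) • v x)) =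
          energy Ω Q (fun x => ((G (wk k x) - G (u x)) • gradient φ x +
            (φ x * G' (wk k x)) • (gradient (wk k) x - v x)) +
            (φ x * (G' (wk k x) - G' (u x))) • v x) := by
        refine lintegral_congr_ae ?_
        filter_upwards [LipOn.ae_differentiableAt hΩ (h1 k),
          ae_restrict_of_ae hφ.ae_differentiableAt] with x hx hx'
        have : gradient (fun x => φ x * G (wk k x)) x -
          (G (u x) • gradient φ x + (φ x * G' (u x)) • v x) =
          ((G (wk k x) - G (u x)) • gradient φ x +
            (φ x * G' (wk k x)) • (gradient (wk k) x - v x)) +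
            (φ x * (G' (wk k x) - G' (u x))) • v x := by
          rw [gradient_mul_comp hx' hx (hG _)]
          module
        rw [this]
      rw [e]
      have m1 : AEMeasurable (fun x => (G (wk k x) - G (u x)) • gradient φ x)
          (volume.restrict Ω) :=
        ((hGc.measurable.comp_aemeasurable (hwm k)).sub hGu).smul hgm.aemeasurable
      have m2 : AEMeasurable (fun x => (φ x * G' (wk k x)) • (gradient (wk k) x - v x))
          (volume.restrict Ω) :=
        (hφm.aemeasurable.mul (hG'.measurable.comp_aemeasurable (hwm k))).smul
          ((measurable_gradient _).aemeasurable.sub huv.aemeasurable)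
      refine (energy_add_le hQ (m1.add m2)).trans ?_
      refine add_le_add (mul_le_mul_right ((energy_add_le hQ m1).trans ?_) 2) le_rfl
      refine add_le_add (mul_le_mul_right ?_ 2) (mul_le_mul_right ?_ 2)
      · rw [hT1]
        simp only
        rw [← lintegral_sq_eq_eLpNorm_sq, ← lintegral_const_mul' _ _ ENNReal.ofReal_ne_top]
        refine lintegral_mono_ae (hℓ.mono fun x hx => ?_)
        rw [← ENNReal.ofReal_mul (by positivity), form_smul_self]
        refine ENNReal.ofReal_le_ofReal ?_
        have h5 : (G (wk k x) - G (u x)) ^ 2 ≤ c ^ 2 * (wk k x - u x) ^ 2 := by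
          rw [← mul_pow, ← sq_abs]
          refine (pow_le_pow_left₀ (abs_nonneg _) (hGd _ _) 2).trans (le_of_eq ?_)
          rw [mul_pow, mul_pow, sq_abs]
        calc _ ≤ (G (wk k x) - G (u x)) ^ 2 * ℓ ^ 2 := mul_le_mul_of_nonneg_left hx (sq_nonneg _)
          _ ≤ (c ^ 2 * (wk k x - u x) ^ 2) * ℓ ^ 2 := mul_le_mul_of_nonneg_right h5 (sq_nonneg _)
          _ = _ := by simp only [Pi.sub_apply]; ring
      · exact energy_mul_le hQ fun x => hcoef x _
    refine tendsto_of_tendsto_of_tendsto_of_le_of_le tendsto_const_nhds ?_ (fun _ => zero_le) hle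
    have t1 : Tendsto T1 atTop (𝓝 0) := by
      have := ENNReal.Tendsto.const_mul (a := ENNReal.ofReal (ℓ ^ 2 * c ^ 2))
        (ENNReal.Tendsto.pow (n := 2) h2) (Or.inr ENNReal.ofReal_ne_top)
      simpa using this
    have t2 : Tendsto T2 atTop (𝓝 0) := by
      have := ENNReal.Tendsto.const_mul (a := ENNReal.ofReal (b ^ 2 * c ^ 2))
        h3 (Or.inr ENNReal.ofReal_ne_top)
      simpa using this
    have t3 : Tendsto T3 atTop (𝓝 0) := by
      have := tendsto_lintegral_of_dominated_convergence' (μ := volume.restrict Ω)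
        (F := fun k x => ENNReal.ofReal (form (Q x)
          ((φ x * (G' (wk k x) - G' (u x))) • v x) ((φ x * (G' (wk k x) - G' (u x))) • v x)))
        (f := fun _ => 0)
        (fun x => ENNReal.ofReal (4 * (b ^ 2 * c ^ 2)) * ENNReal.ofReal (form (Q x) (v x) (v x)))
        (fun k => aemeasurable_energy_density hQ ((hφm.aemeasurable.mul
          ((hG'.measurable.comp_aemeasurable (hwm k)).sub hG'u)).smul huv.aemeasurable))
        (fun k => ?_) ?_ ?_
      · simpa [hT3, energy] using this
      · refine hQ.posSemidef.mono fun x hx => ?_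
        beta_reduce
        rw [← ENNReal.ofReal_mul (by positivity), form_smul_self]
        refine ENNReal.ofReal_le_ofReal (mul_le_mul_of_nonneg_right ?_ (form_self_nonneg hx _))
        have := hcoef x (wk k x)
        have := hcoef x (u x)
        nlinarith [sq_nonneg (φ x * G' (wk k x) + φ x * G' (u x))]
      · rw [lintegral_const_mul' _ _ ENNReal.ofReal_ne_top]
        exact ENNReal.mul_ne_top ENNReal.ofReal_ne_top huv.energy_lt_top.ne
      · filter_upwards [h4] with x hx
        have : Tendsto (fun k => ENNReal.ofReal ((φ x * (G' (wk k x) - G' (u x))) ^ 2 *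
            form (Q x) (v x) (v x))) atTop (𝓝 (ENNReal.ofReal
              ((φ x * (G' (u x) - G' (u x))) ^ 2 * form (Q x) (v x) (v x)))) := by
          refine ENNReal.tendsto_ofReal (Tendsto.mul_const _ (Tendsto.pow (Tendsto.const_mul _ ?_) 2))
          exact ((hG'.tendsto _).comp hx).sub_const _
        simpa [form_smul_self] using this
    have := ((ENNReal.Tendsto.const_mul (a := 2) ((ENNReal.Tendsto.const_mul (a := 2) t1
      (by simp)).add (ENNReal.Tendsto.const_mul (a := 2) t2 (by simp))) (by simp)).add
        (ENNReal.Tendsto.const_mul (a := 2) t3 (by simp)))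
    simpa using this

end Chain

/-! ### The Sobolev inequality with averages over the whole ball -/

section Sobolev

variable {n : ℕ} {Ω B : Set (E n)} {Q : E n → Matrix (Fin n) (Fin n) ℝ}

lemma IsWeight.mono (hQ : IsWeight Ω Q) (hB : B ⊆ Ω) : IsWeight B Q :=
  ⟨fun i j => (hQ.locallyIntegrableOn i j).mono_set hB,
    ae_restrict_of_ae_restrict_of_subset hB hQ.posSemidef⟩

lemma mball_subset {d : E n → E n → ℝ} {x : E n} {r : ℝ} : mball Ω d x r ⊆ Ω := fun _ h => h.1

/-- Around a point `z` of the ball, the triangle inequality and containment with radius `r - d(x,z)`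
give a Euclidean ball. With nonemptiness this makes the metric balls sets of positive measure. -/
lemma isOpen_mball {d : E n → E n → ℝ} (hd : IsMetricOn Ω d) (hc : Containment Ω d) {x : E n}
    (hx : x ∈ Ω) (r : ℝ) : IsOpen (mball Ω d x r) := by
  rw [Metric.isOpen_iff]
  rintro z ⟨hz, hzr⟩
  obtain ⟨α, -, h1, h2⟩ := hc z hz
  have hr : 0 < r - d x z := sub_pos.2 hzr
  refine ⟨α (r - d x z), h1 _ hr, (h2 _ hr mball_subset).trans fun y hy => ⟨hy.1, ?_⟩⟩
  have := hd.triangle x hx z hz y hy.1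
  have := hy.2
  linarith

lemma mem_mball_self {d : E n → E n → ℝ} (hd : IsMetricOn Ω d) {x : E n} (hx : x ∈ Ω) {r : ℝ}
    (hr : 0 < r) : x ∈ mball Ω d x r :=
  ⟨hx, by rw [(hd.eq_zero_iff x hx x hx).2 rfl]; exact hr⟩

lemma form_le_sum_abs_mul {M : Matrix (Fin n) (Fin n) ℝ} {a : E n} {L : ℝ} (ha : ‖a‖ ≤ L) :
    form M a a ≤ ∑ i, ∑ j, |M i j| * L ^ 2 := by
  have hL : 0 ≤ L := (norm_nonneg _).trans ha
  have h : ∀ i, |a i| ≤ L := fun i => (PiLp.norm_apply_le a i).trans ha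
  unfold form
  refine Finset.sum_le_sum fun i _ => Finset.sum_le_sum fun j _ => ?_
  calc a i * M i j * a j ≤ |a i * M i j * a j| := le_abs_self _
    _ = |M i j| * (|a i| * |a j|) := by rw [abs_mul, abs_mul]; ring
    _ ≤ |M i j| * (L * L) := by gcongr <;> exact h _
    _ = _ := by ring

/-- The gradient is bounded and vanishes off a compact subset of `Ω`, where the entries of `Q` are
integrable. -/
lemma energy_gradient_lt_top (hQ : IsWeight Ω Q) (hB : B ⊆ Ω) {φ : E n → ℝ} (hφ : φ ∈ LipC B) :
    energy B Q (gradient φ) < ∞ := by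
  obtain ⟨⟨L, hL⟩, hK, hs⟩ := hφ
  have h1 : ∀ i j, IntegrableOn (fun x => Q x i j) (tsupport φ) := fun i j =>
    (hQ.locallyIntegrableOn i j).integrableOn_compact_subset (hs.trans hB) hK.isCompact
  have h2 : IntegrableOn (fun x => ∑ i, ∑ j, |Q x i j| * (L : ℝ) ^ 2) (tsupport φ) :=
    integrable_finsetSum _ fun i _ => integrable_finsetSum _ fun j _ =>
      ((h1 i j).abs).mul_const _
  calc energy B Q (gradient φ)
      ≤ ∫⁻ x in B, (tsupport φ).indicator
          (fun x => ENNReal.ofReal (∑ i, ∑ j, |Q x i j| * (L : ℝ) ^ 2)) x := by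
        refine lintegral_mono fun x => ?_
        by_cases hx : x ∈ tsupport φ
        · rw [Set.indicator_of_mem hx]
          exact ENNReal.ofReal_le_ofReal (form_le_sum_abs_mul (norm_gradient_le hL x))
        · rw [gradient_eq_zero_of_notMem_tsupport hx]; simp
    _ ≤ ∫⁻ x, (tsupport φ).indicator
          (fun x => ENNReal.ofReal (∑ i, ∑ j, |Q x i j| * (L : ℝ) ^ 2)) x :=
        setLIntegral_le_lintegral _ _
    _ = ∫⁻ x in tsupport φ, ENNReal.ofReal (∑ i, ∑ j, |Q x i j| * (L : ℝ) ^ 2) :=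
        lintegral_indicator (isClosed_tsupport φ).measurableSet _
    _ < ∞ := h2.lintegral_lt_top

/-- Inner regularity supplies a compact set `K` with more than half the measure, and `(ρ - dist(·,
K))⁺` with small `ρ` is the function. It serves to enlarge supports in the Sobolev inequality. -/
lemma exists_lipC_pos_of_isOpen (hB : IsOpen B) (hb : Bornology.IsBounded B)
    (h0 : volume B ≠ 0) :
    ∃ φ ∈ LipC B, (∀ x, 0 ≤ φ x) ∧ volume B / 2 ≤ volume {x | 0 < φ x} := by
  obtain ⟨K, hKB, hK, hlt⟩ := hB.exists_lt_isCompact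
    (ENNReal.half_lt_self h0 hb.measure_lt_top.ne)
  have hne : K.Nonempty := nonempty_of_measure_ne_zero (ne_bot_of_gt hlt)
  obtain ⟨ρ, hρ, hρB⟩ := hK.exists_cthickening_subset_open hB hKB
  have hcl : IsClosed (Metric.cthickening ρ K) := Metric.isClosed_cthickening
  have hsub : tsupport (fun x => max 0 (ρ - Metric.infDist x K)) ⊆ Metric.cthickening ρ K := by
    refine closure_minimal (fun x hx => ?_) hcl
    rw [Metric.cthickening_eq_preimage_infEDist]
    by_contra h
    refine hx (max_eq_left ?_)
    have h' : ENNReal.ofReal ρ < Metric.infEDist x K := not_le.1 h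
    have := (ENNReal.ofReal_lt_iff_lt_toReal hρ.le (Metric.infEDist_ne_top hne)).1 h'
    change ρ < Metric.infDist x K at this
    linarith
  refine ⟨fun x => max 0 (ρ - Metric.infDist x K), ⟨⟨1, ?_⟩, ?_, hsub.trans hρB⟩,
    fun x => le_max_left _ _, hlt.le.trans (measure_mono fun x hx => ?_)⟩
  · refine LipschitzWith.const_max (LipschitzWith.of_dist_le_mul fun x y => ?_) 0
    have := (Metric.lipschitz_infDist_pt K).dist_le_mul x y
    rwa [Real.dist_eq, sub_sub_sub_cancel_left, abs_sub_comm, ← Real.dist_eq]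
  · exact Metric.isCompact_of_isClosed_isBounded (isClosed_tsupport _)
      (hb.subset (hsub.trans hρB))
  · change 0 < max 0 (ρ - Metric.infDist x K)
    rw [Metric.infDist_zero_of_mem hx, sub_zero]
    exact lt_max_of_lt_right hρ

lemma MemWZero.add_smul (hQ : IsWeight B Q) {w φ : E n → ℝ} {v : E n → E n}
    (h : MemWZero B Q w v) (hφ : φ ∈ LipC B) (hφe : energy B Q (gradient φ) < ∞) (ε : ℝ) :
    MemWZero B Q (fun x => w x + ε * φ x) (fun x => v x + ε • gradient φ x) := by
  obtain ⟨⟨L, hL⟩, hK, hs⟩ := hφ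
  have hm : AEMeasurable (fun x => ε • gradient φ x) (volume.restrict B) :=
    ((measurable_gradient φ).const_smul ε).aemeasurable
  obtain ⟨wk, h1, h2, h3⟩ := h.exists_seq
  refine ⟨MemLp.add h.memLp (MemLp.const_mul ?_ ε), h.aemeasurable.add hm, ?_,
    fun k x => wk k x + ε * φ x, fun k => ?_, ?_, ?_⟩
  · exact (hL.continuous.memLp_of_hasCompactSupport hK).restrict _
  · refine (energy_add_le hQ h.aemeasurable).trans_lt (ENNReal.add_lt_top.2
      ⟨ENNReal.mul_lt_top (by simp) h.energy_lt_top, ENNReal.mul_lt_top (by simp) ?_⟩)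
    exact (energy_mul_le hQ (a := fun _ => ε) fun _ => le_rfl).trans_lt
      (ENNReal.mul_lt_top ENNReal.ofReal_lt_top hφe)
  · obtain ⟨⟨L', hL'⟩, hK', hs'⟩ := h1 k
    refine ⟨⟨L' + ‖ε‖₊ * L, hL'.add ?_⟩, hK'.add hK.mul_left, ?_⟩
    · refine LipschitzWith.of_dist_le_mul fun x y => ?_
      have := hL.dist_le_mul x y
      rw [Real.dist_eq] at this ⊢
      rw [← mul_sub, abs_mul, NNReal.coe_mul, coe_nnnorm, Real.norm_eq_abs, mul_assoc]
      exact mul_le_mul_of_nonneg_left this (abs_nonneg _)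
    · refine (tsupport_add _ _).trans (Set.union_subset hs' ?_)
      exact tsupport_mul_subset_right.trans hs
  · refine h2.congr fun k => ?_
    congr 1
    funext x
    simp
  · refine h3.congr fun k => lintegral_congr_ae ?_
    obtain ⟨⟨L', hL'⟩, -, -⟩ := h1 k
    filter_upwards [ae_restrict_of_ae hL'.ae_differentiableAt,
      ae_restrict_of_ae hL.ae_differentiableAt] with x hx hx'
    rw [gradient_add hx (hx'.const_mul ε), gradient_const_mul hx', add_sub_add_right_eq_sub]

lemma ennreal_add_sq_le (a b : ℝ≥0∞) : (a + b) ^ 2 ≤ 2 * a ^ 2 + 2 * b ^ 2 := by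
  have := ENNReal.rpow_add_le_mul_rpow_add_rpow a b (one_le_two)
  norm_num at this
  rw [← mul_add]
  exact_mod_cast this

/-- Adding `ε φ`, with `φ` positive on at least half of the ball, makes the measure of the support
comparable to that of the ball, uniformly in `ε`, while the integrals of the perturbation vanish as
`ε → 0`. The squared inequality yields `8 C²`: a factor 2 each from the square of a sum, from the
measure of the support, and from separating the perturbation. -/
lemma WeakSobolev.whole_ball {d : E n → E n → ℝ} {η σ C : ℝ} (hS : WeakSobolev Ω d Q η σ C)
    (hσ : 1 < σ) (hC : 0 < C) (hd : IsMetricOn Ω d) (hc : Containment Ω d)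
    (hb : Bornology.IsBounded Ω) (hQ : IsWeight Ω Q) {y : E n} (hy : y ∈ Ω) {r : ℝ}
    (hr : IsAdmissibleRadius Ω η y r) {w : E n → ℝ} {v : E n → E n} (hw0 : ∀ x, 0 ≤ w x)
    (hw : MemWZero (mball Ω d y r) Q w v) :
    ((volume (mball Ω d y r))⁻¹ * ∫⁻ x in mball Ω d y r, ENNReal.ofReal (w x ^ (2 * σ))) ^ (1 / σ) ≤
      ENNReal.ofReal (8 * C ^ 2) * ((volume (mball Ω d y r))⁻¹ *
        (ENNReal.ofReal (r ^ 2) * energy (mball Ω d y r) Q v +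
          ∫⁻ x in mball Ω d y r, ENNReal.ofReal (w x ^ 2))) := by
  set B := mball Ω d y r with hBdef
  have hB : IsOpen B := isOpen_mball hd hc hy r
  have hBΩ : B ⊆ Ω := mball_subset
  have hBb : Bornology.IsBounded B := hb.subset hBΩ
  have hvol : volume B ≠ 0 := (hB.measure_pos volume ⟨y, mem_mball_self hd hy hr.1⟩).ne'
  obtain ⟨φ, hφ, hφ0, hφv⟩ := exists_lipC_pos_of_isOpen hB hBb hvol
  have hφe := energy_gradient_lt_top hQ hBΩ hφ
  have hφc : Continuous φ := hφ.1.choose_spec.continuous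
  have hφ2 : MemLp φ 2 (volume.restrict B) :=
    (hφc.memLp_of_hasCompactSupport hφ.2.1).restrict _
  have hφW : ∫⁻ x in B, ENNReal.ofReal (φ x ^ 2) < ∞ := by
    rw [lintegral_sq_eq_eLpNorm_sq]; exact ENNReal.pow_lt_top hφ2.2
  set X := ((volume B)⁻¹ * ∫⁻ x in B, ENNReal.ofReal (w x ^ (2 * σ))) ^ (1 / σ) with hX
  set W := ∫⁻ x in B, ENNReal.ofReal (w x ^ 2) with hW
  set Φ := ∫⁻ x in B, ENNReal.ofReal (φ x ^ 2) with hΦ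
  set F := energy B Q (gradient φ) with hF
  have key : ∀ ε : ℝ, 0 < ε → X ≤ ENNReal.ofReal (8 * C ^ 2) * ((volume B)⁻¹ *
      (ENNReal.ofReal (r ^ 2) * (energy B Q v + ENNReal.ofReal (ε ^ 2) * F) +
        (W + ENNReal.ofReal (ε ^ 2) * Φ))) := by
    intro ε hε
    have h := hS y hy r hr _ _ (hw.add_smul (hQ.mono hBΩ) hφ hφe ε)
    rw [← hBdef] at h
    set w' : E n → ℝ := fun x => w x + ε * φ x with hw'
    -- The set `{φ > 0}` is open and `w + ε φ > 0` on it, so every neighbourhood of its points meets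
    -- the nonzero set in positive measure.
    have hsupp : {x | 0 < φ x} ⊆ suppIn B w' := by
      have hpos : {x | 0 < φ x} ⊆ B ∩ Function.support w' := fun x hx =>
        ⟨hφ.2.2 (subset_tsupport _ (ne_of_gt hx)),
          (add_pos_of_nonneg_of_pos (hw0 x) (mul_pos hε hx)).ne'⟩
      refine fun x hx => ⟨(hpos hx).1, ?_⟩
      refine Measure.support_mono (Measure.restrict_mono hpos le_rfl)
        (Measure.interior_inter_support ⟨?_, ?_⟩)
      · rwa [(isOpen_lt continuous_const hφc).interior_eq]
      · rw [Measure.support_eq_univ]; trivial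
    have hS1 : (volume B)⁻¹ ≤ (volume (suppIn B w'))⁻¹ :=
      ENNReal.inv_le_inv.2 (measure_mono Set.inter_subset_left)
    have hS2 : (volume (suppIn B w'))⁻¹ ≤ 2 * (volume B)⁻¹ := by
      refine (ENNReal.inv_le_inv.2 (hφv.trans (measure_mono hsupp))).trans (le_of_eq ?_)
      rw [ENNReal.inv_div (by simp) (by simp), ENNReal.div_eq_inv_mul, mul_comm]
    have hE : energy B Q (fun x => v x + ε • gradient φ x) ≤
        2 * (energy B Q v + ENNReal.ofReal (ε ^ 2) * F) := by
      rw [mul_add]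
      refine (energy_add_le (hQ.mono hBΩ) hw.aemeasurable).trans ?_
      gcongr
      exact energy_mul_le (hQ.mono hBΩ) (a := fun _ => ε) fun _ => le_rfl
    have hWε : ∫⁻ x in B, ENNReal.ofReal (|w' x| ^ 2) ≤ 2 * (W + ENNReal.ofReal (ε ^ 2) * Φ) := by
      rw [hW, hΦ, ← lintegral_const_mul' _ _ ENNReal.ofReal_ne_top, ← lintegral_add_left'
        ((hw.memLp.1.aemeasurable.pow_const 2).ennreal_ofReal),
        ← lintegral_const_mul' _ _ (by simp)]
      refine lintegral_mono fun x => ?_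
      have h2 : ∀ t : ℝ, (2 : ℝ≥0∞) * ENNReal.ofReal t = ENNReal.ofReal (2 * t) := fun t => by
        rw [ENNReal.ofReal_mul zero_le_two, ENNReal.ofReal_ofNat]
      rw [← ENNReal.ofReal_mul (sq_nonneg _), ← ENNReal.ofReal_add (sq_nonneg _) (by positivity), h2]
      refine ENNReal.ofReal_le_ofReal ?_
      rw [sq_abs, hw']
      nlinarith [sq_nonneg (w x - ε * φ x)]
    have hXle : X ≤ ((volume (suppIn B w'))⁻¹ *
        ∫⁻ x in B, ENNReal.ofReal (|w' x| ^ (2 * σ))) ^ (1 / σ) := by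
      refine ENNReal.rpow_le_rpow (mul_le_mul' hS1 (lintegral_mono fun x => ?_)) (by positivity)
      refine ENNReal.ofReal_le_ofReal (Real.rpow_le_rpow (hw0 x) ?_ (by linarith))
      exact (le_add_of_nonneg_right (mul_nonneg hε.le (hφ0 x))).trans (le_abs_self _)
    have hsq : ∀ Z : ℝ≥0∞, (Z ^ (1 / 2 : ℝ)) ^ 2 = Z := fun Z => by
      rw [← ENNReal.rpow_natCast, ← ENNReal.rpow_mul]; norm_num
    calc X ≤ _ := hXle
      _ = (((volume (suppIn B w'))⁻¹ *
          ∫⁻ x in B, ENNReal.ofReal (|w' x| ^ (2 * σ))) ^ (1 / (2 * σ))) ^ 2 := by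
        rw [← ENNReal.rpow_natCast, ← ENNReal.rpow_mul]
        congr 1
        push_cast
        field_simp
      _ ≤ _ := pow_le_pow_left' h 2
      _ ≤ 2 * (ENNReal.ofReal (C * r) ^ 2 *
            ((2 * (volume B)⁻¹) * (2 * (energy B Q v + ENNReal.ofReal (ε ^ 2) * F)))) +
          2 * (ENNReal.ofReal C ^ 2 *
            ((2 * (volume B)⁻¹) * (2 * (W + ENNReal.ofReal (ε ^ 2) * Φ)))) := by
        refine (ennreal_add_sq_le _ _).trans ?_
        rw [mul_pow, mul_pow, hsq, hsq]
        gcongr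
      _ = _ := by
        rw [ENNReal.ofReal_mul (by norm_num : (0 : ℝ) ≤ 8), ENNReal.ofReal_mul hC.le,
          ENNReal.ofReal_pow hC.le, ENNReal.ofReal_pow hr.1.le, ENNReal.ofReal_ofNat]
        ring
  have ht : ∀ Z : ℝ≥0∞, Z < ∞ →
      Tendsto (fun ε : ℝ => ENNReal.ofReal (ε ^ 2) * Z) (𝓝[>] 0) (𝓝 0) := fun Z hZ => by
    have h1 : Tendsto (fun ε : ℝ => ENNReal.ofReal (ε ^ 2)) (𝓝[>] 0) (𝓝 (ENNReal.ofReal (0 ^ 2))) :=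
      ENNReal.tendsto_ofReal (((continuous_pow 2).tendsto (0 : ℝ)).mono_left nhdsWithin_le_nhds)
    have h2 := ENNReal.Tendsto.mul_const (b := Z) h1 (Or.inr hZ.ne)
    simpa using h2
  have hlim : Tendsto (fun ε : ℝ => ENNReal.ofReal (8 * C ^ 2) * ((volume B)⁻¹ *
      (ENNReal.ofReal (r ^ 2) * (energy B Q v + ENNReal.ofReal (ε ^ 2) * F) +
        (W + ENNReal.ofReal (ε ^ 2) * Φ)))) (𝓝[>] 0) (𝓝 (ENNReal.ofReal (8 * C ^ 2) *
          ((volume B)⁻¹ * (ENNReal.ofReal (r ^ 2) * (energy B Q v + 0) + (W + 0))))) := by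
    refine ENNReal.Tendsto.const_mul (ENNReal.Tendsto.const_mul (Tendsto.add
      (ENNReal.Tendsto.const_mul (tendsto_const_nhds.add (ht F hφe))
        (Or.inr ENNReal.ofReal_ne_top)) (tendsto_const_nhds.add (ht Φ hφW)))
        (Or.inr (ENNReal.inv_ne_top.2 hvol))) (Or.inr ENNReal.ofReal_ne_top)
  rw [add_zero, add_zero] at hlim
  exact ge_of_tendsto hlim (eventually_mem_nhdsWithin.mono fun ε hε => key ε hε)

end Sobolev

/-! ### A smooth truncation -/

section Trunc

/-- A `C¹` function that vanishes for `s ≤ 0` and has slope one for `s ≥ Δ`. -/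
noncomputable def trunc (Δ s : ℝ) : ℝ := ((max s 0) ^ 2 - (max (s - Δ) 0) ^ 2) / (2 * Δ)

/-- The derivative of `trunc Δ`. -/
noncomputable def truncDeriv (Δ s : ℝ) : ℝ := (max s 0 - max (s - Δ) 0) / Δ

lemma hasDerivAt_max_zero_sq (s : ℝ) : HasDerivAt (fun s : ℝ => (max s 0) ^ 2) (2 * max s 0) s := by
  rcases lt_trichotomy s 0 with h | h | h
  · rw [max_eq_right h.le, mul_zero]
    refine (hasDerivAt_const s (0 : ℝ)).congr_of_eventuallyEq ?_
    filter_upwards [gt_mem_nhds h] with t ht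
    rw [max_eq_right (le_of_lt ht)]; norm_num
  · subst h
    rw [max_self, mul_zero, hasDerivAt_iff_isLittleO_nhds_zero]
    have h1 : (fun t : ℝ => t ^ 2) =o[𝓝 0] fun t : ℝ => t := by
      simpa using Asymptotics.isLittleO_pow_id (𝕜 := ℝ) one_lt_two
    refine Asymptotics.IsBigO.trans_isLittleO (Asymptotics.IsBigO.of_bound 1 ?_) h1
    refine Eventually.of_forall fun t => ?_
    simp only [zero_add, max_self, smul_zero, sub_zero, Real.norm_eq_abs, one_mul]
    rw [zero_pow two_ne_zero, sub_zero, abs_pow, abs_pow]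
    refine pow_le_pow_left₀ (abs_nonneg _) ?_ 2
    rw [abs_of_nonneg (le_max_right _ _)]
    exact max_le (le_abs_self t) (abs_nonneg t)
  · rw [max_eq_left h.le]
    refine (by simpa using hasDerivAt_pow 2 s : HasDerivAt (fun s : ℝ => s ^ 2) (2 * s)
      s).congr_of_eventuallyEq ?_
    filter_upwards [lt_mem_nhds h] with t ht
    rw [max_eq_left (le_of_lt ht)]

lemma hasDerivAt_trunc {Δ : ℝ} (hΔ : 0 < Δ) (s : ℝ) : HasDerivAt (trunc Δ) (truncDeriv Δ s) s := by
  have h1 := hasDerivAt_max_zero_sq s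
  have h2 : HasDerivAt (fun s : ℝ => (max (s - Δ) 0) ^ 2) (2 * max (s - Δ) 0) s := by
    simpa using HasDerivAt.comp_sub_const s Δ (hasDerivAt_max_zero_sq (s - Δ))
  have h3 := (h1.sub h2).div_const (2 * Δ)
  refine h3.congr_deriv ?_
  rw [truncDeriv]; field_simp

lemma continuous_truncDeriv (Δ : ℝ) : Continuous (truncDeriv Δ) := by
  unfold truncDeriv; fun_prop

lemma truncDeriv_nonneg {Δ : ℝ} (hΔ : 0 < Δ) (s : ℝ) : 0 ≤ truncDeriv Δ s :=
  div_nonneg (sub_nonneg.2 (max_le_max_right 0 (by linarith))) hΔ.le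

lemma truncDeriv_le_one {Δ : ℝ} (hΔ : 0 < Δ) (s : ℝ) : truncDeriv Δ s ≤ 1 := by
  rw [truncDeriv, div_le_one hΔ]
  rcases max_cases s 0 with h | h <;> rcases max_cases (s - Δ) 0 with h' | h' <;> linarith

/-- This comparison passes from the level `κ` to `κ + Δ`: the positive part at the new level is
below the smooth truncation at the old one. -/
lemma max_sub_le_trunc {Δ : ℝ} (hΔ : 0 < Δ) (s : ℝ) : max (s - Δ) 0 ≤ trunc Δ s := by
  rw [trunc, le_div_iff₀ (by linarith)]
  rcases max_cases s 0 with h | h <;> rcases max_cases (s - Δ) 0 with h' | h' <;>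
    rw [h.1, h'.1] <;> nlinarith

lemma trunc_nonneg {Δ : ℝ} (hΔ : 0 < Δ) (s : ℝ) : 0 ≤ trunc Δ s :=
  (le_max_right _ _).trans (max_sub_le_trunc hΔ s)

lemma trunc_le_max {Δ : ℝ} (hΔ : 0 < Δ) (s : ℝ) : trunc Δ s ≤ max s 0 := by
  rw [trunc, div_le_iff₀ (by linarith)]
  rcases max_cases s 0 with h | h <;> rcases max_cases (s - Δ) 0 with h' | h' <;>
    rw [h.1, h'.1] <;> nlinarith

/-- The quadratic onset of `trunc` makes the source term, linear in the test function, controllable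
by the integral of `((u - κ)⁺)²`. -/
lemma trunc_le_sq_div {Δ : ℝ} (hΔ : 0 < Δ) (s : ℝ) : trunc Δ s ≤ max s 0 ^ 2 / Δ := by
  rw [trunc, div_le_div_iff₀ (by linarith) hΔ]
  nlinarith [mul_nonneg (sq_nonneg (max s 0)) hΔ.le, mul_nonneg (sq_nonneg (max (s - Δ) 0)) hΔ.le]

/-- Above `Δ` the slope is 1 and `trunc Δ s ≤ s⁺`; below, `trunc Δ s` is the slope times `s⁺ / 2`,
and the slope is at most 1. This relation lets the mixed term of the test function be absorbed,
since the good term carries only the weight `truncDeriv`. -/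
lemma trunc_sq_le {Δ : ℝ} (hΔ : 0 < Δ) (s : ℝ) :
    trunc Δ s ^ 2 ≤ truncDeriv Δ s * max s 0 ^ 2 := by
  rcases le_or_gt Δ s with h | h
  · have : truncDeriv Δ s = 1 := by
      rw [truncDeriv, max_eq_left (by linarith), max_eq_left (by linarith), sub_sub_cancel,
        div_self hΔ.ne']
    rw [this, one_mul]
    exact pow_le_pow_left₀ (trunc_nonneg hΔ s) (trunc_le_max hΔ s) 2
  · have h1 : trunc Δ s = truncDeriv Δ s * (max s 0 / 2) := by
      rw [trunc, truncDeriv, max_eq_right (by linarith : s - Δ ≤ 0)]; field_simp; ring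
    have h2 : 0 ≤ max s 0 := le_max_right _ _
    rw [h1, mul_pow]
    have h3 := truncDeriv_nonneg hΔ s
    have h4 := truncDeriv_le_one hΔ s
    have h5 : truncDeriv Δ s ^ 2 ≤ truncDeriv Δ s := by nlinarith
    have h6 : (max s 0 / 2) ^ 2 ≤ max s 0 ^ 2 := by nlinarith [sq_nonneg (max s 0)]
    exact mul_le_mul h5 h6 (sq_nonneg _) h3

end Trunc

/-! ### The energy inequality -/

section Caccioppoli

variable {n : ℕ} {Ω B : Set (E n)} {Q a : E n → Matrix (Fin n) (Fin n) ℝ}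

/-- `(u, v)` is a weak solution of the linear equation `∇ᵀ a(x) ∇u = f`, for a coefficient matrix
comparable to `Q`. -/
structure IsLinearSolution (Ω : Set (E n)) (Q : E n → Matrix (Fin n) (Fin n) ℝ) (k K : ℝ)
    (a : E n → Matrix (Fin n) (Fin n) ℝ) (f u : E n → ℝ) (v : E n → E n) : Prop where
  memW : MemW Ω Q u v
  aemeasurable : ∀ i j, AEMeasurable (fun x => a x i j) (volume.restrict Ω)
  posSemidef : ∀ᵐ x ∂(volume.restrict Ω), (a x).PosSemidef
  bounds : ∀ᵐ x ∂(volume.restrict Ω), ∀ ξ : E n,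
    k * form (Q x) ξ ξ ≤ form (a x) ξ ξ ∧ form (a x) ξ ξ ≤ K * form (Q x) ξ ξ
  equation : ∀ (w : E n → ℝ) (g : E n → E n), MemWZero Ω Q w g →
    (∀ᵐ x ∂(volume.restrict Ω), 0 ≤ w x) →
    -∫ x in Ω, form (a x) (v x) (g x) = ∫ x in Ω, f x * w x

lemma integrable_energy_density (hQ : IsWeight Ω Q) {g : E n → E n}
    (hg : AEMeasurable g (volume.restrict Ω)) (he : energy Ω Q g < ∞) :
    Integrable (fun x => form (Q x) (g x) (g x)) (volume.restrict Ω) := by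
  refine ⟨(aemeasurable_form hQ.aemeasurable hg hg).aestronglyMeasurable, ?_⟩
  rw [hasFiniteIntegral_iff_ofReal (hQ.posSemidef.mono fun x hx => form_self_nonneg hx _)]
  exact he

/-- The pointwise inequality behind the energy inequality. -/
lemma form_test_ge {M : Matrix (Fin n) (Fin n) ℝ} (hM : M.PosSemidef) (v p : E n)
    {ψ h H s : ℝ} (h0 : 0 ≤ h) (hH : H ^ 2 ≤ h * s ^ 2) :
    ψ ^ 2 * h * form M v v / 2 ≤
      form M v (H • ((2 * ψ) • p) + (ψ ^ 2 * h) • v) + 2 * s ^ 2 * form M p p := by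
  rw [form_add_right, form_smul_right, form_smul_right, form_smul_right]
  have hX := form_self_nonneg hM v
  have hY := form_self_nonneg hM p
  have hXY := form_sq_le hM v p
  -- With `α = ψ² h (vᵀMv) / 2` and `β = 2 s² (pᵀMp)`, Cauchy-Schwarz bounds the squared mixed term
  -- by `4αβ ≤ (α + β)²`.
  have h1 : (H * (2 * ψ * form M v p)) ^ 2 ≤
      (ψ ^ 2 * h * form M v v / 2 + 2 * s ^ 2 * form M p p) ^ 2 := by
    calc (H * (2 * ψ * form M v p)) ^ 2 = H ^ 2 * (4 * ψ ^ 2 * form M v p ^ 2) := by ring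
      _ ≤ (h * s ^ 2) * (4 * ψ ^ 2 * (form M v v * form M p p)) := by gcongr
      _ ≤ _ := by
        nlinarith [sq_nonneg (ψ ^ 2 * h * form M v v / 2 - 2 * s ^ 2 * form M p p)]
  have h2 := abs_le_of_sq_le_sq h1 (by positivity)
  linarith [neg_abs_le (H * (2 * ψ * form M v p))]

lemma setLIntegral_indicator_of_subset {S : Set (E n)} (hS : MeasurableSet S) (hSΩ : S ⊆ Ω)
    (g : E n → ℝ≥0∞) : ∫⁻ x in Ω, S.indicator g x = ∫⁻ x in S, g x := by
  rw [lintegral_indicator hS, Measure.restrict_restrict hS, Set.inter_eq_left.2 hSΩ]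

/-- The energy inequality of Caccioppoli. -/
lemma IsLinearSolution.caccioppoli (hΩ : IsOpen Ω) (hb : Bornology.IsBounded Ω)
    (hQ : IsWeight Ω Q) {k K : ℝ} (hk : 0 < k) (hkK : k ≤ K) {f u : E n → ℝ} {v : E n → E n}
    (hsol : IsLinearSolution Ω Q k K a f u v) {F : ℝ}
    (hf : ∀ᵐ x ∂(volume.restrict Ω), |f x| ≤ F) (hfm : AEMeasurable f (volume.restrict Ω))
    {ψ : E n → ℝ} {L : NNReal} (hψ : LipschitzWith L ψ)
    (hψ0 : ∀ x, 0 ≤ ψ x) (hψ1 : ∀ x, ψ x ≤ 1) (hs : tsupport ψ ⊆ Ω) {ℓ : ℝ}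
    (hℓ : ∀ᵐ x ∂(volume.restrict Ω), form (Q x) (gradient ψ x) (gradient ψ x) ≤ ℓ ^ 2)
    (κ : ℝ) {Δ : ℝ} (hΔ : 0 < Δ) :
    energy Ω Q (fun x => (ψ x * truncDeriv Δ (u x - κ)) • v x) ≤
      ENNReal.ofReal ((4 * K * ℓ ^ 2 + 2 * (F / Δ)) / k) *
        ∫⁻ x in tsupport ψ, ENNReal.ofReal (max (u x - κ) 0 ^ 2) := by
  have hK0 : 0 < K := hk.trans_le hkK
  have hfin : IsFiniteMeasure (volume.restrict Ω) := ⟨by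
    rw [Measure.restrict_apply_univ]; exact hb.measure_lt_top⟩
  have hSm : MeasurableSet (tsupport ψ) := (isClosed_tsupport ψ).measurableSet
  have hcomp : HasCompactSupport ψ :=
    Metric.isCompact_of_isClosed_isBounded (isClosed_tsupport ψ) (hb.subset hs)
  obtain ⟨L', hψψ⟩ := exists_lipschitzWith_mul hψ hcomp hψ
  have hψsq : LipschitzWith L' fun x => ψ x ^ 2 := by simpa only [sq] using hψψ
  have hssq : tsupport (fun x => ψ x ^ 2) ⊆ Ω := by
    simp only [sq]; exact tsupport_mul_subset_left.trans hs
  have hℓsq : ∀ᵐ x ∂(volume.restrict Ω),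
      form (Q x) (gradient (fun x => ψ x ^ 2) x) (gradient (fun x => ψ x ^ 2) x) ≤ (2 * ℓ) ^ 2 := by
    filter_upwards [hℓ, ae_restrict_of_ae hψ.ae_differentiableAt, hQ.posSemidef] with x hx hd hp
    rw [gradient_sq hd, form_smul_self, mul_pow, mul_pow, mul_assoc]
    refine mul_le_mul_of_nonneg_left ?_ (by norm_num)
    have := form_self_nonneg hp (gradient ψ x)
    have : ψ x ^ 2 ≤ 1 := pow_le_one₀ (hψ0 x) (hψ1 x)
    nlinarith
  set h : E n → ℝ := fun x => truncDeriv Δ (u x - κ) with hh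
  set H : E n → ℝ := fun x => trunc Δ (u x - κ) with hHdef
  set s : E n → ℝ := fun x => max (u x - κ) 0 with hsdef
  have htest : MemWZero Ω Q (fun x => ψ x ^ 2 * H x)
      (fun x => H x • gradient (fun x => ψ x ^ 2) x + (ψ x ^ 2 * h x) • v x) :=
    hsol.memW.memWZero_mul_comp (G := fun t => trunc Δ (t - κ))
      (G' := fun t => truncDeriv Δ (t - κ)) (c := 1) hΩ hb subset_rfl hQ hψsq hssq hℓsq
      (fun t => (hasDerivAt_trunc hΔ (t - κ)).comp_sub_const t κ)
      ((continuous_truncDeriv Δ).comp (continuous_sub_right κ))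
      fun t => by rw [abs_of_nonneg (truncDeriv_nonneg hΔ _)]; exact truncDeriv_le_one hΔ _
  set g : E n → E n := fun x => H x • gradient (fun x => ψ x ^ 2) x + (ψ x ^ 2 * h x) • v x with hg
  have heq := hsol.equation _ _ htest (Eventually.of_forall fun x =>
    mul_nonneg (sq_nonneg _) (trunc_nonneg hΔ _))
  have hum : AEMeasurable u (volume.restrict Ω) := hsol.memW.memLp.1.aemeasurable
  have hhm : AEMeasurable h (volume.restrict Ω) :=
    (continuous_truncDeriv Δ).measurable.comp_aemeasurable (hum.sub_const κ)
  have hs2 : MemLp s 2 (volume.restrict Ω) := by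
    have h1 : MemLp (fun x => u x - κ) 2 (volume.restrict Ω) :=
      MemLp.sub hsol.memW.memLp (memLp_const κ)
    refine h1.mono ((hum.sub_const κ).max aemeasurable_const).aestronglyMeasurable
      (Eventually.of_forall fun x => ?_)
    rw [Real.norm_eq_abs, Real.norm_eq_abs, abs_of_nonneg (le_max_right _ _)]
    exact max_le (le_abs_self _) (abs_nonneg _)
  set I : E n → ℝ := (tsupport ψ).indicator fun x => s x ^ 2 with hI
  have hI0 : ∀ x, 0 ≤ I x := fun x => Set.indicator_nonneg (fun _ _ => sq_nonneg _) x
  have hIint : Integrable I (volume.restrict Ω) := hs2.integrable_sq.indicator hSm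
  have hvint := integrable_energy_density hQ hsol.memW.aemeasurable hsol.memW.energy_lt_top
  have hgint := integrable_energy_density hQ htest.aemeasurable htest.energy_lt_top
  -- Integrability is needed to split the integral: the Bochner integral in the equation would be 0
  -- by convention otherwise.
  have haint : Integrable (fun x => form (a x) (v x) (g x)) (volume.restrict Ω) := by
    refine ((hvint.add hgint).const_mul K).mono' (aemeasurable_form hsol.aemeasurable
      hsol.memW.aemeasurable htest.aemeasurable).aestronglyMeasurable ?_
    filter_upwards [hsol.posSemidef, hsol.bounds] with x hx hx'
    refine (abs_form_le hx _ _).trans ?_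
    have h1 := (hx' (v x)).2
    have h2 := (hx' (g x)).2
    simp only [Pi.add_apply]
    linarith
  -- The part of the energy left after half of the good term has absorbed the mixed term.
  set P : E n → ℝ := fun x => k / 2 * (ψ x ^ 2 * h x) * form (Q x) (v x) (v x) with hP
  have hcoef : ∀ x, 0 ≤ ψ x ^ 2 * h x ∧ ψ x ^ 2 * h x ≤ 1 := fun x =>
    ⟨mul_nonneg (sq_nonneg _) (truncDeriv_nonneg hΔ _),
      mul_le_one₀ (pow_le_one₀ (hψ0 x) (hψ1 x)) (truncDeriv_nonneg hΔ _) (truncDeriv_le_one hΔ _)⟩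
  have hP0 : 0 ≤ᵐ[volume.restrict Ω] P := by
    filter_upwards [hQ.posSemidef] with x hx
    exact mul_nonneg (mul_nonneg (by positivity) (hcoef x).1) (form_self_nonneg hx _)
  have hPint : Integrable P (volume.restrict Ω) := by
    refine (hvint.const_mul (k / 2)).mono' ?_ ?_
    · exact ((((hψ.continuous.measurable.pow_const 2).aemeasurable.mul hhm).const_mul _).mul
        (aemeasurable_form hQ.aemeasurable hsol.memW.aemeasurable
          hsol.memW.aemeasurable)).aestronglyMeasurable
    · filter_upwards [hQ.posSemidef, hP0] with x hx hx'
      rw [Real.norm_of_nonneg hx', hP]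
      refine mul_le_mul_of_nonneg_right ?_ (form_self_nonneg hx _)
      have := (hcoef x).2
      nlinarith
  have hpt : ∀ᵐ x ∂(volume.restrict Ω),
      P x ≤ form (a x) (v x) (g x) + 2 * K * ℓ ^ 2 * I x := by
    filter_upwards [hsol.posSemidef, hsol.bounds, hℓ, ae_restrict_of_ae hψ.ae_differentiableAt]
      with x hx hbd hl hd
    have h1 := form_test_ge hx (v x) (gradient ψ x) (ψ := ψ x) (truncDeriv_nonneg hΔ (u x - κ))
      (trunc_sq_le hΔ (u x - κ))
    have h2 : P x ≤ ψ x ^ 2 * h x * form (a x) (v x) (v x) / 2 := by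
      have := mul_le_mul_of_nonneg_left (hbd (v x)).1 (hcoef x).1
      rw [hP]
      linarith
    have h3 : 2 * s x ^ 2 * form (a x) (gradient ψ x) (gradient ψ x) ≤ 2 * K * ℓ ^ 2 * I x := by
      by_cases hxS : x ∈ tsupport ψ
      · rw [hI, Set.indicator_of_mem hxS]
        have := (hbd (gradient ψ x)).2
        have h4 : form (a x) (gradient ψ x) (gradient ψ x) ≤ K * ℓ ^ 2 :=
          this.trans (mul_le_mul_of_nonneg_left hl hK0.le)
        nlinarith [mul_le_mul_of_nonneg_left h4 (sq_nonneg (s x))]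
      · rw [gradient_eq_zero_of_notMem_tsupport hxS, form_zero_left, mul_zero]
        have := hI0 x
        positivity
    have h5 : g x = H x • ((2 * ψ x) • gradient ψ x) + (ψ x ^ 2 * h x) • v x := by
      rw [hg]; simp only; rw [gradient_sq hd]
    rw [h5]
    linarith
  have hfw : ∀ᵐ x ∂(volume.restrict Ω), |f x * (ψ x ^ 2 * H x)| ≤ F / Δ * I x := by
    filter_upwards [hf] with x hx
    have hF : 0 ≤ F := (abs_nonneg _).trans hx
    by_cases hxS : x ∈ tsupport ψ
    · rw [hI, Set.indicator_of_mem hxS, abs_mul, abs_mul, abs_of_nonneg (sq_nonneg (ψ x)),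
        abs_of_nonneg (trunc_nonneg hΔ _)]
      calc |f x| * (ψ x ^ 2 * H x) ≤ F * (1 * (s x ^ 2 / Δ)) := by
            gcongr
            · exact mul_nonneg (sq_nonneg _) (trunc_nonneg hΔ _)
            · exact trunc_nonneg hΔ _
            · exact pow_le_one₀ (hψ0 x) (hψ1 x)
            · exact trunc_le_sq_div hΔ _
        _ = _ := by ring
    · rw [image_eq_zero_of_notMem_tsupport hxS]
      have := hI0 x
      simp only [ne_eq, OfNat.ofNat_ne_zero, not_false_eq_true, zero_pow, zero_mul, mul_zero,
        abs_zero]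
      positivity
  have hle : ∫ x in Ω, P x ≤ (2 * K * ℓ ^ 2 + F / Δ) * ∫ x in Ω, I x := by
    have h1 : ∫ x in Ω, P x ≤ ∫ x in Ω, (form (a x) (v x) (g x) + 2 * K * ℓ ^ 2 * I x) :=
      integral_mono_ae hPint (haint.add (hIint.const_mul _)) hpt
    rw [integral_add haint (hIint.const_mul _), integral_const_mul] at h1
    have h2 : -∫ x in Ω, f x * (ψ x ^ 2 * H x) ≤ F / Δ * ∫ x in Ω, I x := by
      rw [← integral_const_mul]
      refine (neg_le_abs _).trans (abs_integral_le_integral_abs.trans ?_)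
      refine integral_mono_ae ?_ (hIint.const_mul _) hfw
      refine Integrable.abs ((hIint.const_mul (F / Δ)).mono' ?_ hfw)
      exact (hfm.mul htest.memLp.1.aemeasurable).aestronglyMeasurable
    linarith
  have hIl : ∫⁻ x in tsupport ψ, ENNReal.ofReal (s x ^ 2) = ENNReal.ofReal (∫ x in Ω, I x) := by
    rw [ofReal_integral_eq_lintegral_ofReal hIint (Eventually.of_forall hI0),
      ← setLIntegral_indicator_of_subset hSm hs]
    refine lintegral_congr fun x => ?_
    by_cases hxS : x ∈ tsupport ψ
    · rw [hI, Set.indicator_of_mem hxS, Set.indicator_of_mem hxS]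
    · rw [hI, Set.indicator_of_notMem hxS, Set.indicator_of_notMem hxS, ENNReal.ofReal_zero]
  have hIi : 0 ≤ ∫ x in Ω, I x := integral_nonneg hI0
  rw [hIl, ← ENNReal.ofReal_mul' hIi]
  calc energy Ω Q (fun x => (ψ x * h x) • v x)
      ≤ ∫⁻ x in Ω, ENNReal.ofReal (2 / k * P x) := by
        -- The slope lies in `[0, 1]`, so its square in the energy is at most the first power in
        -- `P`.
        refine lintegral_mono_ae (hQ.posSemidef.mono fun x hx => ENNReal.ofReal_le_ofReal ?_)
        rw [form_smul_self, hP]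
        have h1 : 2 / k * (k / 2 * (ψ x ^ 2 * h x) * form (Q x) (v x) (v x)) =
            (ψ x ^ 2 * h x) * form (Q x) (v x) (v x) := by field_simp
        simp only
        rw [h1, mul_pow]
        refine mul_le_mul_of_nonneg_right (mul_le_mul_of_nonneg_left ?_ (sq_nonneg _))
          (form_self_nonneg hx _)
        rw [sq]
        exact mul_le_of_le_one_left (truncDeriv_nonneg hΔ _) (truncDeriv_le_one hΔ _)
    _ = ENNReal.ofReal (∫ x in Ω, 2 / k * P x) :=
        (ofReal_integral_eq_lintegral_ofReal (hPint.const_mul _)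
          (hP0.mono fun x hx => mul_nonneg (by positivity) hx)).symm
    _ ≤ _ := by
        refine ENNReal.ofReal_le_ofReal ?_
        rw [integral_const_mul]
        calc _ ≤ 2 / k * ((2 * K * ℓ ^ 2 + F / Δ) * ∫ x in Ω, I x) :=
              mul_le_mul_of_nonneg_left hle (by positivity)
          _ = _ := by field_simp; ring

/-- The energy of a truncation of a solution, localized by a cutoff function. -/
lemma IsLinearSolution.energy_trunc_le (hΩ : IsOpen Ω) (hb : Bornology.IsBounded Ω)
    (hQ : IsWeight Ω Q) {k K : ℝ} (hk : 0 < k) (hkK : k ≤ K) {f u : E n → ℝ} {v : E n → E n}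
    (hsol : IsLinearSolution Ω Q k K a f u v) {F : ℝ} (hF : 0 ≤ F)
    (hf : ∀ᵐ x ∂(volume.restrict Ω), |f x| ≤ F) (hfm : AEMeasurable f (volume.restrict Ω))
    (hB : B ⊆ Ω) {ψ : E n → ℝ} {L : NNReal} (hψ : LipschitzWith L ψ)
    (hψ0 : ∀ x, 0 ≤ ψ x) (hψ1 : ∀ x, ψ x ≤ 1) (hs : tsupport ψ ⊆ B) {ℓ : ℝ}
    (hℓ : ∀ᵐ x ∂(volume.restrict Ω), form (Q x) (gradient ψ x) (gradient ψ x) ≤ ℓ ^ 2)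
    (κ : ℝ) {Δ : ℝ} (hΔ : 0 < Δ) :
    ∃ g, MemWZero B Q (fun x => ψ x * trunc Δ (u x - κ)) g ∧
      energy B Q g ≤ ENNReal.ofReal (2 * ℓ ^ 2 + 2 * ((4 * K * ℓ ^ 2 + 2 * (F / Δ)) / k)) *
        ∫⁻ x in tsupport ψ, ENNReal.ofReal (max (u x - κ) 0 ^ 2) := by
  have hK0 : 0 < K := hk.trans_le hkK
  have hSm : MeasurableSet (tsupport ψ) := (isClosed_tsupport ψ).measurableSet
  refine ⟨_, hsol.memW.memWZero_mul_comp (G := fun t => trunc Δ (t - κ))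
      (G' := fun t => truncDeriv Δ (t - κ)) (c := 1) hΩ hb hB hQ hψ hs hℓ
      (fun t => (hasDerivAt_trunc hΔ (t - κ)).comp_sub_const t κ)
      ((continuous_truncDeriv Δ).comp (continuous_sub_right κ))
      (fun t => by rw [abs_of_nonneg (truncDeriv_nonneg hΔ _)]; exact truncDeriv_le_one hΔ _), ?_⟩
  have hum : AEMeasurable u (volume.restrict Ω) := hsol.memW.memLp.1.aemeasurable
  have hHm : Continuous (trunc Δ) :=
    continuous_iff_continuousAt.2 fun s => (hasDerivAt_trunc hΔ s).continuousAt
  have h1 : energy Ω Q (fun x => trunc Δ (u x - κ) • gradient ψ x) ≤ ENNReal.ofReal (ℓ ^ 2) *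
      ∫⁻ x in tsupport ψ, ENNReal.ofReal (max (u x - κ) 0 ^ 2) := by
    rw [← lintegral_const_mul' _ _ ENNReal.ofReal_ne_top,
      ← setLIntegral_indicator_of_subset hSm (hs.trans hB)]
    refine lintegral_mono_ae (hℓ.mono fun x hx => ?_)
    by_cases hxS : x ∈ tsupport ψ
    · rw [Set.indicator_of_mem hxS, ← ENNReal.ofReal_mul (sq_nonneg _), form_smul_self]
      refine ENNReal.ofReal_le_ofReal ?_
      rw [mul_comm (ℓ ^ 2)]
      have h2 : trunc Δ (u x - κ) ^ 2 ≤ max (u x - κ) 0 ^ 2 :=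
        pow_le_pow_left₀ (trunc_nonneg hΔ _) (trunc_le_max hΔ _) 2
      exact (mul_le_mul_of_nonneg_left hx (sq_nonneg _)).trans
        (mul_le_mul_of_nonneg_right h2 (sq_nonneg _))
    · simp [gradient_eq_zero_of_notMem_tsupport hxS]
  have h2 := hsol.caccioppoli hΩ hb hQ hk hkK hf hfm hψ hψ0 hψ1 (hs.trans hB) hℓ κ hΔ
  refine (energy_mono_set hB _).trans ((energy_add_le hQ
    ((hHm.measurable.comp_aemeasurable (hum.sub_const κ)).smul
      (measurable_gradient ψ).aemeasurable)).trans ?_)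
  calc _ ≤ 2 * (ENNReal.ofReal (ℓ ^ 2) *
        ∫⁻ x in tsupport ψ, ENNReal.ofReal (max (u x - κ) 0 ^ 2)) +
      2 * (ENNReal.ofReal ((4 * K * ℓ ^ 2 + 2 * (F / Δ)) / k) *
        ∫⁻ x in tsupport ψ, ENNReal.ofReal (max (u x - κ) 0 ^ 2)) :=
        add_le_add (mul_le_mul_right h1 2) (mul_le_mul_right h2 2)
    _ = _ := by
      rw [ENNReal.ofReal_add (by positivity) (by positivity), ENNReal.ofReal_mul zero_le_two,
        ENNReal.ofReal_mul zero_le_two, ENNReal.ofReal_ofNat]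
      ring

end Caccioppoli

/-! ### The iteration -/

section Iteration

/-- Fast geometric convergence. -/
lemma geometric_decay {z : ℕ → ℝ} {A D α θ : ℝ} (hα : 0 < α) (hD : 0 ≤ D) (hA : 0 ≤ A)
    (hθ : 0 ≤ θ) (hz : ∀ i, 0 ≤ z i) (hstep : ∀ i, z (i + 1) ≤ A * D ^ i * (z i * z i ^ α))
    (hDθ : D * θ ^ α ≤ 1) (h0 : A * z 0 ^ α ≤ θ) (i : ℕ) : z i ≤ θ ^ i * z 0 := by
  induction i with
  | zero => simp
  | succ i ih =>
    have h1 : z i ^ α ≤ (θ ^ α) ^ i * z 0 ^ α := by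
      refine (Real.rpow_le_rpow (hz i) ih hα.le).trans (le_of_eq ?_)
      rw [Real.mul_rpow (pow_nonneg hθ i) (hz 0), ← Real.rpow_natCast, ← Real.rpow_natCast,
        ← Real.rpow_mul hθ, ← Real.rpow_mul hθ, mul_comm α]
    have hp : 0 ≤ θ ^ α := Real.rpow_nonneg hθ α
    have hz0 : 0 ≤ z 0 ^ α := Real.rpow_nonneg (hz 0) α
    have hDp : (D * θ ^ α) ^ i ≤ 1 := pow_le_one₀ (mul_nonneg hD hp) hDθ
    calc z (i + 1) ≤ A * D ^ i * (z i * z i ^ α) := hstep i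
      _ ≤ A * D ^ i * ((θ ^ i * z 0) * ((θ ^ α) ^ i * z 0 ^ α)) := by
          have := hz 0
          have := Real.rpow_nonneg (hz i) α
          gcongr
      _ = (D * θ ^ α) ^ i * (A * z 0 ^ α) * (θ ^ i * z 0) := by rw [mul_pow]; ring
      _ ≤ 1 * θ * (θ ^ i * z 0) := by
          have := hz 0
          gcongr
      _ = θ ^ (i + 1) * z 0 := by ring

variable {n : ℕ} {Ω B : Set (E n)} {Q a : E n → Matrix (Fin n) (Fin n) ℝ}

/-- The integral of `((u - κ)⁺)²` over `S`. -/
noncomputable def levelMass (u : E n → ℝ) (S : Set (E n)) (κ : ℝ) : ℝ≥0∞ :=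
  ∫⁻ x in S, ENNReal.ofReal (max (u x - κ) 0 ^ 2)

lemma levelMass_mono {u : E n → ℝ} {S T : Set (E n)} (h : S ⊆ T) {κ κ' : ℝ} (hκ : κ' ≤ κ) :
    levelMass u S κ ≤ levelMass u T κ' := by
  refine (lintegral_mono_set h).trans (lintegral_mono fun x => ENNReal.ofReal_le_ofReal ?_)
  exact pow_le_pow_left₀ (le_max_right _ _) (max_le_max_right 0 (by linarith)) 2

lemma levelMass_le_lintegral_sq (u : E n → ℝ) (S : Set (E n)) {κ : ℝ} (hκ : 0 ≤ κ) :
    levelMass u S κ ≤ ∫⁻ x in S, ENNReal.ofReal (u x ^ 2) := by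
  refine lintegral_mono fun x => ENNReal.ofReal_le_ofReal ?_
  rcases max_cases (u x - κ) 0 with h | h <;> rw [h.1] <;> nlinarith [sq_nonneg (u x)]

/-- With `b = |B|⁻¹`, this turns the product in Hölder's inequality into a product of averages. -/
lemma ennreal_mul_rpow_split {b : ℝ≥0∞} (hb0 : b ≠ 0) (hb : b ≠ ∞) {p q : ℝ} (hp : 0 ≤ p)
    (hq : 0 ≤ q) (hpq : p + q = 1) (x y : ℝ≥0∞) :
    b * (x ^ p * y ^ q) = (b * x) ^ p * (b * y) ^ q := by
  rw [ENNReal.mul_rpow_of_nonneg _ _ hp, ENNReal.mul_rpow_of_nonneg _ _ hq]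
  nth_rewrite 1 [← ENNReal.rpow_one b]
  rw [← hpq, ENNReal.rpow_add _ _ hb0 hb]
  ring

/-- Hölder's inequality and Chebyshev's inequality on a superlevel set. -/
lemma levelMass_add_le {u w : E n → ℝ} {S : Set (E n)} {σ κ Δ : ℝ} (hσ : 1 < σ) (hΔ : 0 < Δ)
    (hS : MeasurableSet S)
    (hu : AEMeasurable u (volume.restrict S)) (hw : AEMeasurable w (volume.restrict S))
    (hw0 : ∀ x, 0 ≤ w x) (h : ∀ x ∈ S, max (u x - (κ + Δ)) 0 ≤ w x) :
    levelMass u S (κ + Δ) ≤ (∫⁻ x in S, ENNReal.ofReal (w x ^ (2 * σ))) ^ (1 / σ) *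
      (ENNReal.ofReal (1 / Δ ^ 2) * levelMass u S κ) ^ (1 - 1 / σ) := by
  have hσ0 : 0 < σ := by linarith
  have hpq : σ.HolderConjugate (σ / (σ - 1)) := Real.HolderConjugate.conjExponent hσ
  -- The indicator of the superlevel set is the second Hölder factor. On that set `(u - κ)² / Δ² ≥
  -- 1`, which is Chebyshev's bound.
  set g : ℝ → ℝ≥0∞ := fun t => if κ + Δ < t then 1 else 0 with hg
  have hgm : Measurable g := Measurable.ite measurableSet_Ioi measurable_const measurable_const
  calc levelMass u S (κ + Δ)
      ≤ ∫⁻ x in S, ((fun x => ENNReal.ofReal (w x ^ 2)) * fun x => g (u x)) x := by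
        refine setLIntegral_mono' hS fun x hx => ?_
        simp only [Pi.mul_apply, hg]
        by_cases hx' : κ + Δ < u x
        · rw [if_pos hx', mul_one]
          exact ENNReal.ofReal_le_ofReal (pow_le_pow_left₀ (le_max_right _ _) (h x hx) 2)
        · rw [if_neg hx', mul_zero, max_eq_right (by linarith)]; simp
    _ ≤ (∫⁻ x in S, ENNReal.ofReal (w x ^ 2) ^ σ) ^ (1 / σ) *
        (∫⁻ x in S, g (u x) ^ (σ / (σ - 1))) ^ (1 / (σ / (σ - 1))) :=
        ENNReal.lintegral_mul_le_Lp_mul_Lq _ hpq (hw.pow_const 2).ennreal_ofReal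
          (hgm.comp_aemeasurable hu)
    _ ≤ _ := by
        rw [show 1 / (σ / (σ - 1)) = 1 - 1 / σ by field_simp]
        refine mul_le_mul' (ENNReal.rpow_le_rpow (lintegral_mono fun x => ?_) (by positivity))
          (ENNReal.rpow_le_rpow ?_ (sub_nonneg.2 ((div_le_one hσ0).2 hσ.le)))
        · rw [ENNReal.ofReal_rpow_of_nonneg (sq_nonneg _) hσ0.le, ← Real.rpow_natCast,
            ← Real.rpow_mul (hw0 x)]
          norm_num
        · rw [levelMass, ← lintegral_const_mul' _ _ ENNReal.ofReal_ne_top]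
          refine lintegral_mono fun x => ?_
          have hq : 0 < σ / (σ - 1) := div_pos hσ0 (by linarith)
          simp only [hg]
          by_cases hx' : κ + Δ < u x
          · rw [if_pos hx', ENNReal.one_rpow, ← ENNReal.ofReal_mul (by positivity),
              ENNReal.one_le_ofReal, max_eq_left (by linarith), one_div,
              inv_mul_eq_div, one_le_div (by positivity)]
            exact pow_le_pow_left₀ hΔ.le (by linarith) 2
          · rw [if_neg hx', ENNReal.zero_rpow_of_pos hq]; exact zero_le

/-- One step of the iteration. -/
lemma IsLinearSolution.levelMass_step {d : E n → E n → ℝ} {η σ Cs : ℝ}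
    (hS : WeakSobolev Ω d Q η σ Cs) (hσ : 1 < σ) (hCs : 0 < Cs) (hd : IsMetricOn Ω d)
    (hc : Containment Ω d) (hΩ : IsOpen Ω) (hb : Bornology.IsBounded Ω)
    (hQ : IsWeight Ω Q) {k K : ℝ} (hk : 0 < k) (hkK : k ≤ K) {f u : E n → ℝ} {v : E n → E n}
    (hsol : IsLinearSolution Ω Q k K a f u v) {F : ℝ} (hF : 0 ≤ F)
    (hf : ∀ᵐ x ∂(volume.restrict Ω), |f x| ≤ F) (hfm : AEMeasurable f (volume.restrict Ω))
    {y : E n} (hy : y ∈ Ω) {r : ℝ} (hr : IsAdmissibleRadius Ω η y r)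
    {χ : E n → ℝ} {L : NNReal} (hχ : LipschitzWith L χ)
    (hχ0 : ∀ x, 0 ≤ χ x) (hχ1 : ∀ x, χ x ≤ 1) {S T : Set (E n)} (hχS : tsupport χ ⊆ S)
    (hSB : S ⊆ mball Ω d y r) (hT : MeasurableSet T) (hTS : T ⊆ S) (hTχ : ∀ x ∈ T, χ x = 1)
    {ℓ : ℝ} (hℓ : ∀ᵐ x ∂(volume.restrict Ω), form (Q x) (gradient χ x) (gradient χ x) ≤ ℓ ^ 2)
    (κ : ℝ) {Δ : ℝ} (hΔ : 0 < Δ) :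
    (volume (mball Ω d y r))⁻¹ * levelMass u T (κ + Δ) ≤
      ENNReal.ofReal (8 * Cs ^ 2 *
        (r ^ 2 * (2 * ℓ ^ 2 + 2 * ((4 * K * ℓ ^ 2 + 2 * (F / Δ)) / k)) + 1)) *
      ((volume (mball Ω d y r))⁻¹ * levelMass u S κ) *
      (ENNReal.ofReal (1 / Δ ^ 2) * ((volume (mball Ω d y r))⁻¹ * levelMass u S κ)) ^
        (1 - 1 / σ) := by
  have hK0 : 0 < K := hk.trans_le hkK
  have hσ0 : 0 < σ := by linarith
  set B := mball Ω d y r with hBdef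
  have hB : IsOpen B := isOpen_mball hd hc hy r
  have hBΩ : B ⊆ Ω := mball_subset
  have hb0 : volume B ≠ 0 := (hB.measure_pos volume ⟨y, mem_mball_self hd hy hr.1⟩).ne'
  have hbt : volume B ≠ ∞ := (hb.subset hBΩ).measure_lt_top.ne
  obtain ⟨g, hg, hge⟩ := hsol.energy_trunc_le hΩ hb hQ hk hkK hF hf hfm hBΩ hχ hχ0 hχ1
    (hχS.trans hSB) hℓ κ hΔ
  set w : E n → ℝ := fun x => χ x * trunc Δ (u x - κ) with hw
  have hw0 : ∀ x, 0 ≤ w x := fun x => mul_nonneg (hχ0 x) (trunc_nonneg hΔ _)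
  have hI : ∫⁻ x in tsupport χ, ENNReal.ofReal (max (u x - κ) 0 ^ 2) ≤ levelMass u S κ :=
    lintegral_mono_set hχS
  have hsob := hS.whole_ball hσ hCs hd hc hb hQ hy hr hw0 hg
  rw [← hBdef] at hsob
  have hw2 : ∫⁻ x in B, ENNReal.ofReal (w x ^ 2) ≤ levelMass u S κ := by
    refine le_trans ?_ hI
    rw [← setLIntegral_indicator_of_subset (isClosed_tsupport χ).measurableSet (hχS.trans hSB)]
    refine lintegral_mono fun x => ?_
    by_cases hx : x ∈ tsupport χ
    · rw [Set.indicator_of_mem hx]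
      refine ENNReal.ofReal_le_ofReal (pow_le_pow_left₀ (hw0 x) ?_ 2)
      exact (mul_le_of_le_one_left (trunc_nonneg hΔ _) (hχ1 x)).trans (trunc_le_max hΔ _)
    · simp [hw, image_eq_zero_of_notMem_tsupport hx]
  set e := 2 * ℓ ^ 2 + 2 * ((4 * K * ℓ ^ 2 + 2 * (F / Δ)) / k) with he
  have he0 : 0 ≤ e := by positivity
  have hsob2 : ((volume B)⁻¹ * ∫⁻ x in B, ENNReal.ofReal (w x ^ (2 * σ))) ^ (1 / σ) ≤
      ENNReal.ofReal (8 * Cs ^ 2 * (r ^ 2 * e + 1)) * ((volume B)⁻¹ * levelMass u S κ) := by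
    refine hsob.trans ?_
    calc _ ≤ ENNReal.ofReal (8 * Cs ^ 2) * ((volume B)⁻¹ *
          (ENNReal.ofReal (r ^ 2) * (ENNReal.ofReal e * levelMass u S κ) + levelMass u S κ)) := by
          gcongr
          exact hge.trans (mul_le_mul_right hI _)
      _ = _ := by
          rw [ENNReal.ofReal_mul (p := 8 * Cs ^ 2) (by positivity),
            ENNReal.ofReal_add (by positivity) zero_le_one, ENNReal.ofReal_mul (sq_nonneg r),
            ENNReal.ofReal_one]
          ring
  have hTΩ : volume.restrict T ≤ volume.restrict Ω :=
    Measure.restrict_mono (hTS.trans (hSB.trans hBΩ)) le_rfl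
  have hTB : volume.restrict T ≤ volume.restrict B :=
    Measure.restrict_mono (hTS.trans hSB) le_rfl
  have hlev := levelMass_add_le (u := u) (w := w) (κ := κ) hσ hΔ hT
    (hsol.memW.memLp.1.aemeasurable.mono_measure hTΩ)
    (hg.memLp.1.aemeasurable.mono_measure hTB) hw0
    (fun x hx => by
      simp only [hw, hTχ x hx, one_mul, ← sub_sub]
      exact max_sub_le_trunc hΔ _)
  have hα : 0 ≤ 1 - 1 / σ := sub_nonneg.2 ((div_le_one hσ0).2 hσ.le)
  calc (volume B)⁻¹ * levelMass u T (κ + Δ)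
      ≤ (volume B)⁻¹ * ((∫⁻ x in B, ENNReal.ofReal (w x ^ (2 * σ))) ^ (1 / σ) *
        (ENNReal.ofReal (1 / Δ ^ 2) * levelMass u S κ) ^ (1 - 1 / σ)) := by
        refine mul_le_mul_right (hlev.trans ?_) _
        refine mul_le_mul' (ENNReal.rpow_le_rpow (lintegral_mono_set (hTS.trans hSB))
          (by positivity)) (ENNReal.rpow_le_rpow ?_ hα)
        exact mul_le_mul_right (levelMass_mono hTS le_rfl) _
    _ = ((volume B)⁻¹ * ∫⁻ x in B, ENNReal.ofReal (w x ^ (2 * σ))) ^ (1 / σ) *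
        ((volume B)⁻¹ * (ENNReal.ofReal (1 / Δ ^ 2) * levelMass u S κ)) ^ (1 - 1 / σ) :=
        ennreal_mul_rpow_split (ENNReal.inv_ne_zero.2 hbt) (ENNReal.inv_ne_top.2 hb0)
          (by positivity) hα (by ring) _ _
    _ ≤ _ := by
        rw [mul_left_comm (volume B)⁻¹]
        exact mul_le_mul_left hsob2 _

end Iteration

/-! ### Cutoff functions with values in `[0, 1]` -/

section Cutoff

variable {n : ℕ} {Ω : Set (E n)} {d : E n → E n → ℝ} {Q : E n → Matrix (Fin n) (Fin n) ℝ}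
  {δ : E n → ℝ → ℝ} {ν C : ℝ} {y : E n} {r : ℝ} {ψ : ℕ → E n → ℝ}

lemma tsupport_clamp_subset (φ : E n → ℝ) : tsupport (fun x => clamp (φ x)) ⊆ tsupport φ := by
  refine closure_mono fun x hx h => hx ?_
  simp [show φ x = 0 from h]

lemma IsAccumulating.tsupport_succ_subset (h : IsAccumulating Ω d Q δ ν C y r ψ) {j : ℕ}
    (hj : 1 ≤ j) : tsupport (ψ (j + 1)) ⊆ tsupport (ψ j) := fun x hx =>
  subset_tsupport _ (by
    rw [Function.mem_support, show ψ j x = 1 from h.nested j hj hx]; exact one_ne_zero)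

lemma IsAccumulating.tsupport_subset_mball (h : IsAccumulating Ω d Q δ ν C y r ψ) {j : ℕ}
    (hj : 1 ≤ j) : tsupport (ψ j) ⊆ mball Ω d y r := by
  induction j, hj using Nat.le_induction with
  | base => exact h.tsupport_subset
  | succ j hj ih => exact (h.tsupport_succ_subset hj).trans ih

lemma IsAccumulating.mball_subset_tsupport (h : IsAccumulating Ω d Q δ ν C y r ψ) {j : ℕ}
    (hj : 1 ≤ j) : mball Ω d y (ν * r) ⊆ tsupport (ψ j) := fun x hx =>
  subset_tsupport _ (by
    rw [Function.mem_support, show ψ j x = 1 from h.eq_one j hj hx]; exact one_ne_zero)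

/-- The assumed bound lives on the ball only; it extends to `Ω` because the gradient vanishes off
the support. -/
lemma IsAccumulating.form_gradient_clamp_le (h : IsAccumulating Ω d Q δ ν C y r ψ)
    (hB : IsOpen (mball Ω d y r)) (hQ : IsWeight Ω Q) {j : ℕ} (hj : 1 ≤ j) :
    ∀ᵐ x ∂(volume.restrict Ω), form (Q x) (gradient (fun x => clamp (ψ j x)) x)
      (gradient (fun x => clamp (ψ j x)) x) ≤
        (C / ((1 - ν) * δ y (ν * r) * (1 - δ y (ν * r) / r) ^ j)) ^ 2 := by
  obtain ⟨L, hL⟩ := h.lipschitz j hj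
  have h1 := (ae_restrict_iff' hB.measurableSet).1 (h.gradient_le j hj)
  filter_upwards [ae_restrict_of_ae h1, hQ.posSemidef, ae_restrict_of_ae hL.ae_differentiableAt]
    with x hx hp hd
  by_cases hxB : x ∈ mball Ω d y r
  · have h2 := hx hxB
    rcases gradient_clamp hd with h3 | h3
    · rw [h3, form_zero_left]; exact sq_nonneg _
    · rw [h3, ← Real.sq_sqrt (form_self_nonneg hp (gradient (ψ j) x))]
      exact pow_le_pow_left₀ (Real.sqrt_nonneg _) h2 2
  · have : x ∉ tsupport (fun x => clamp (ψ j x)) := fun h' =>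
      hxB (h.tsupport_subset_mball hj (tsupport_clamp_subset _ h'))
    rw [gradient_eq_zero_of_notMem_tsupport this, form_zero_left]
    exact sq_nonneg _

end Cutoff

/-! ### The local bound -/

section LocalBound

/-- The factor in the coefficients of the iteration that does not grow along it. -/
noncomputable def stepConst (ν k K Cs Cψ : ℝ) : ℝ :=
  8 * Cs ^ 2 * ((2 + 8 * K / k) * (Cψ / (1 - ν)) ^ 2 + 4 / k + 1)

/-- The ratio at which the coefficients of the iteration grow. -/
noncomputable def stepRatio (ν : ℝ) : ℝ := 8 * (1 / (1 - ν)) ^ 2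

/-- The constant of the local bound. -/
noncomputable def boundConst (σ ν k K Cs Cψ : ℝ) : ℝ :=
  (stepConst ν k K Cs Cψ * stepRatio ν / stepRatio ν ^ (-(1 / (1 - 1 / σ)))) ^
    (1 / (2 * (1 - 1 / σ)))

lemma stepConst_pos {ν k K Cs Cψ : ℝ} (hν1 : ν < 1) (hk : 0 < k) (hkK : k ≤ K) (hCs : 0 < Cs)
    (hCψ : 0 < Cψ) : 0 < stepConst ν k K Cs Cψ := by
  have hK : 0 < K := hk.trans_le hkK
  have : 0 < 1 - ν := by linarith
  unfold stepConst
  positivity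

lemma one_le_inv_one_sub {ν : ℝ} (hν : 0 < ν) (hν1 : ν < 1) : 1 ≤ 1 / (1 - ν) := by
  rw [one_le_div (by linarith)]; linarith

/-- From `t ≤ ν r` follows `1/(1 - t/r) ≤ 1/(1 - ν)`, so the cutoff gradients grow geometrically at
a rate independent of `t`; only `(r/t)²` remembers `t`. From `r² F ≤ M` the source contributes at
most `2^(i+1)`, the inverse of the relative level step. -/
lemma stepCoeff_le {ν k K Cs Cψ r t F M : ℝ} (hν : 0 < ν) (hν1 : ν < 1) (hk : 0 < k) (hkK : k ≤ K)
    (hCψ : 0 < Cψ) (hr : 0 < r) (ht : 0 < t) (htr : t ≤ ν * r) (hM : 0 < M)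
    (hFM : r ^ 2 * F ≤ M) (i : ℕ) :
    8 * Cs ^ 2 * (r ^ 2 * (2 * (Cψ / ((1 - ν) * t * (1 - t / r) ^ (i + 1))) ^ 2 +
      2 * ((4 * K * (Cψ / ((1 - ν) * t * (1 - t / r) ^ (i + 1))) ^ 2 +
        2 * (F / (M * (1 / 2) ^ (i + 1)))) / k)) + 1) ≤
      stepConst ν k K Cs Cψ * (r / t) ^ 2 * (2 * (1 / (1 - ν)) ^ 2) ^ (i + 1) := by
  have hK : 0 < K := hk.trans_le hkK
  have h1ν : 0 < 1 - ν := by linarith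
  have hb := one_le_inv_one_sub hν hν1
  set b := 1 / (1 - ν) with hbdef
  have hτ : t / r ≤ ν := (div_le_iff₀ hr).2 htr
  have hτ1 : 0 < 1 - t / r := by linarith
  have hρ : 1 ≤ r / t := by rw [one_le_div ht]; nlinarith
  have hρ2 : 1 ≤ (r / t) ^ 2 := one_le_pow₀ hρ
  set p := (2 * b ^ 2) ^ (i + 1) with hp
  have hp1 : (2 : ℝ) ^ (i + 1) ≤ p := by
    refine pow_le_pow_left₀ zero_le_two ?_ _
    nlinarith
  have hp2 : (b ^ 2) ^ (i + 1) ≤ p := by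
    refine pow_le_pow_left₀ (sq_nonneg _) ?_ _
    nlinarith
  have hp3 : 1 ≤ p := (one_le_pow₀ one_le_two).trans hp1
  have hℓ : r ^ 2 * (Cψ / ((1 - ν) * t * (1 - t / r) ^ (i + 1))) ^ 2 ≤
      (Cψ / (1 - ν)) ^ 2 * ((r / t) ^ 2 * p) := by
    have h1 : 1 / (1 - t / r) ≤ b := one_div_le_one_div_of_le h1ν (by linarith)
    have h2 : r ^ 2 * (Cψ / ((1 - ν) * t * (1 - t / r) ^ (i + 1))) ^ 2 =
        (Cψ / (1 - ν)) ^ 2 * ((r / t) ^ 2 * ((1 / (1 - t / r)) ^ 2) ^ (i + 1)) := by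
      rw [one_div, inv_pow, inv_pow, ← pow_mul, mul_comm 2 (i + 1), pow_mul]
      field_simp
    rw [h2]
    have h3 : ((1 / (1 - t / r)) ^ 2) ^ (i + 1) ≤ p := by
      refine le_trans ?_ hp2
      have : 0 ≤ 1 / (1 - t / r) := by positivity
      gcongr
    gcongr
  have hFΔ : r ^ 2 * (F / (M * (1 / 2) ^ (i + 1))) ≤ (r / t) ^ 2 * p := by
    have h1 : r ^ 2 * (F / (M * (1 / 2) ^ (i + 1))) = (r ^ 2 * F) / M * 2 ^ (i + 1) := by
      rw [one_div, inv_pow]; field_simp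
    have h2 : (r ^ 2 * F) / M ≤ 1 := (div_le_one hM).2 hFM
    rw [h1]
    calc (r ^ 2 * F) / M * 2 ^ (i + 1) ≤ 1 * p := by gcongr
      _ ≤ (r / t) ^ 2 * p := by gcongr
  have h1 : 1 ≤ (r / t) ^ 2 * p := one_le_mul_of_one_le_of_one_le hρ2 hp3
  have hsplit : ∀ x y : ℝ, r ^ 2 * (2 * x + 2 * ((4 * K * x + 2 * y) / k)) + 1 =
    (2 + 8 * K / k) * (r ^ 2 * x) + 4 / k * (r ^ 2 * y) + 1 := fun x y => by field_simp; ring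
  have hrhs : stepConst ν k K Cs Cψ * (r / t) ^ 2 * p = 8 * Cs ^ 2 *
      (((2 + 8 * K / k) * (Cψ / (1 - ν)) ^ 2 + 4 / k + 1) * ((r / t) ^ 2 * p)) := by
    rw [stepConst]; ring
  rw [hsplit, hrhs]
  refine mul_le_mul_of_nonneg_left ?_ (by positivity)
  calc _ ≤ (2 + 8 * K / k) * ((Cψ / (1 - ν)) ^ 2 * ((r / t) ^ 2 * p)) +
        4 / k * ((r / t) ^ 2 * p) + (r / t) ^ 2 * p := by gcongr
    _ = _ := by ring

lemma toReal_le_of_le_mul_rpow {x x' : ℝ≥0∞} {p c α : ℝ} (hx : x ≠ ∞) (hα : 0 ≤ α) (hp : 0 ≤ p)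
    (hc : 0 ≤ c) (h : x' ≤ ENNReal.ofReal p * x * (ENNReal.ofReal c * x) ^ α) :
    x'.toReal ≤ p * x.toReal * (c * x.toReal) ^ α := by
  have h1 := ENNReal.toReal_mono (ENNReal.mul_ne_top (ENNReal.mul_ne_top ENNReal.ofReal_ne_top
    hx) (ENNReal.rpow_ne_top_of_nonneg hα (ENNReal.mul_ne_top ENNReal.ofReal_ne_top hx))) h
  rwa [ENNReal.toReal_mul, ENNReal.toReal_mul, ← ENNReal.toReal_rpow, ENNReal.toReal_mul,
    ENNReal.toReal_ofReal hp, ENNReal.toReal_ofReal hc] at h1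

variable {n : ℕ} {Ω : Set (E n)} {Q a : E n → Matrix (Fin n) (Fin n) ℝ}

/-- The iteration for the levels `M (1 - 2⁻ⁱ)`. -/
lemma IsLinearSolution.ae_le {d : E n → E n → ℝ} {δ : E n → ℝ → ℝ} {η σ ν k K Cs Cψ : ℝ}
    (hσ : 1 < σ) (hν : 0 < ν) (hν1 : ν < 1) (hk : 0 < k) (hkK : k ≤ K) (hCs : 0 < Cs)
    (hCψ : 0 < Cψ) (hΩ : IsOpen Ω) (hb : Bornology.IsBounded Ω) (hd : IsMetricOn Ω d)
    (hc : Containment Ω d) (hQ : IsWeight Ω Q) (hS : WeakSobolev Ω d Q η σ Cs)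
    {f u : E n → ℝ} {v : E n → E n}
    (hsol : IsLinearSolution Ω Q k K a f u v) {F : ℝ} (hF : 0 ≤ F)
    (hf : ∀ᵐ x ∂(volume.restrict Ω), |f x| ≤ F) (hfm : AEMeasurable f (volume.restrict Ω))
    {y : E n} (hy : y ∈ Ω) {r : ℝ} (hr : IsAdmissibleRadius Ω η y r) {ψ : ℕ → E n → ℝ}
    (hψ : IsAccumulating Ω d Q δ ν Cψ y r ψ) (hδ : 0 < δ y (ν * r)) (hδr : δ y (ν * r) ≤ ν * r)
    {A M : ℝ} (hA : 0 ≤ A)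
    (hAu : (volume (mball Ω d y r))⁻¹ * ∫⁻ x in mball Ω d y r, ENNReal.ofReal (u x ^ 2) ≤
      ENNReal.ofReal (A ^ 2))
    (hM : 0 < M) (hFM : r ^ 2 * F ≤ M)
    (hAM : boundConst σ ν k K Cs Cψ * (r / δ y (ν * r)) ^ (σ / (σ - 1)) * A ≤ M) :
    ∀ᵐ x ∂(volume.restrict (mball Ω d y (ν * r))), u x ≤ M := by
  set B := mball Ω d y r with hBdef
  set t := δ y (ν * r) with htdef
  have hσ0 : 0 < σ := by linarith
  have hB : IsOpen B := isOpen_mball hd hc hy r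
  have hBΩ : B ⊆ Ω := mball_subset
  have hb0 : volume B ≠ 0 := (hB.measure_pos volume ⟨y, mem_mball_self hd hy hr.1⟩).ne'
  have hbt : volume B ≠ ∞ := (hb.subset hBΩ).measure_lt_top.ne
  set α := 1 - 1 / σ with hα
  have hα0 : 0 < α := sub_pos.2 ((div_lt_one hσ0).2 hσ)
  have hα1 : α ≤ 1 := sub_le_self _ (by positivity)
  have hαinv : σ / (σ - 1) = 1 / α := by
    have : σ - 1 ≠ 0 := by linarith
    rw [hα]; field_simp
  set κ : ℕ → ℝ := fun i => M * (1 - (1 / 2) ^ i) with hκ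
  set Δ : ℕ → ℝ := fun i => M * (1 / 2) ^ (i + 1) with hΔ
  have hΔ0 : ∀ i, 0 < Δ i := fun i => by positivity
  have hκΔ : ∀ i, κ (i + 1) = κ i + Δ i := fun i => by simp only [hκ, hΔ]; ring
  have hκ0 : ∀ i, 0 ≤ κ i := fun i =>
    mul_nonneg hM.le (sub_nonneg.2 (pow_le_one₀ (by norm_num) (by norm_num)))
  have hκM : ∀ i, κ i ≤ M := fun i =>
    mul_le_of_le_one_right hM.le (sub_le_self _ (by positivity))
  -- The index is shifted because the cutoff functions start at `ψ 1`.
  set X : ℕ → ℝ≥0∞ := fun i => (volume B)⁻¹ * levelMass u (tsupport (ψ (i + 1))) (κ i) with hX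
  have hXA : ∀ i, X i ≤ ENNReal.ofReal (A ^ 2) := fun i => by
    refine le_trans (mul_le_mul_right ?_ _) hAu
    exact (levelMass_le_lintegral_sq u _ (hκ0 i)).trans
      (lintegral_mono_set (hψ.tsupport_subset_mball (by omega)))
  have hXt : ∀ i, X i ≠ ∞ := fun i => ((hXA i).trans_lt ENNReal.ofReal_lt_top).ne
  have hstep : ∀ i, X (i + 1) ≤
      ENNReal.ofReal (stepConst ν k K Cs Cψ * (r / t) ^ 2 * (2 * (1 / (1 - ν)) ^ 2) ^ (i + 1)) *
        X i * (ENNReal.ofReal (1 / Δ i ^ 2) * X i) ^ α := by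
    intro i
    obtain ⟨L, hL⟩ := hψ.lipschitz (i + 1) (by omega)
    have h := hsol.levelMass_step hS hσ hCs hd hc hΩ hb hQ hk hkK hF hf hfm hy hr
      (lipschitzWith_clamp.comp hL) (fun x => clamp_nonneg _) (fun x => clamp_le_one _)
      (tsupport_clamp_subset _) (hψ.tsupport_subset_mball (by omega))
      (isClosed_tsupport (ψ (i + 1 + 1))).measurableSet (hψ.tsupport_succ_subset (by omega))
      (fun x hx => by
        have h1 : ψ (i + 1) x = 1 := hψ.nested (i + 1) (by omega) hx
        simp [h1])
      (hψ.form_gradient_clamp_le hB hQ (by omega)) (κ i) (hΔ0 i)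
    rw [← hκΔ] at h
    refine h.trans ?_
    refine mul_le_mul' (mul_le_mul_left (ENNReal.ofReal_le_ofReal ?_) _) le_rfl
    exact stepCoeff_le hν hν1 hk hkK hCψ hr.1 hδ hδr hM hFM i
  have hρ : 1 ≤ r / t := by
    rw [one_le_div hδ]; nlinarith [hr.1]
  have hA0 := stepConst_pos hν1 hk hkK hCs hCψ
  set A₀ := stepConst ν k K Cs Cψ with hA₀
  have hb1 := one_le_inv_one_sub hν hν1
  have hD1 : 1 ≤ stepRatio ν := by unfold stepRatio; nlinarith
  set D := stepRatio ν with hD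
  have hD0 : 0 < D := by linarith
  -- The largest ratio allowed by `geometric_decay`, for which `D θ^α = 1`.
  set θ := D ^ (-(1 / α)) with hθ
  have hθ0 : 0 < θ := Real.rpow_pos_of_pos hD0 _
  have hDθ : D * θ ^ α = 1 := by
    rw [hθ, ← Real.rpow_mul hD0.le, neg_mul, one_div_mul_cancel hα0.ne', Real.rpow_neg_one,
      mul_inv_cancel₀ hD0.ne']
  set z : ℕ → ℝ := fun i => (X i).toReal / M ^ 2 with hz
  have hz0 : ∀ i, 0 ≤ z i := fun i => by positivity
  have hzstep : ∀ i, z (i + 1) ≤ (A₀ * (r / t) ^ 2 * D) * D ^ i * (z i * z i ^ α) := by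
    intro i
    have h1 := toReal_le_of_le_mul_rpow (hXt i) hα0.le (by positivity) (by positivity) (hstep i)
    have h2 : 1 / Δ i ^ 2 * (X i).toReal = 4 ^ (i + 1) * z i := by
      have h4 : ((1 / 2 : ℝ) ^ (i + 1)) ^ 2 = 1 / 4 ^ (i + 1) := by
        rw [← pow_mul, mul_comm, pow_mul, ← one_div_pow]; norm_num
      simp only [hΔ, hz]
      rw [mul_pow, h4]
      field_simp
    -- Since `α ≤ 1`, Chebyshev contributes at most `4^(i+1)`. Multiplied by the growth
    -- `(2/(1-ν)²)^(i+1)` of the coefficient, it gives the power `i + 1` of `stepRatio ν`.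
    have h3 : (4 ^ (i + 1) * z i) ^ α ≤ 4 ^ (i + 1) * z i ^ α := by
      rw [Real.mul_rpow (by positivity) (hz0 i)]
      refine mul_le_mul_of_nonneg_right ?_ (Real.rpow_nonneg (hz0 i) _)
      exact Real.rpow_le_self_of_one_le (one_le_pow₀ (by norm_num)) hα1
    rw [h2] at h1
    have h5 : z (i + 1) ≤ A₀ * (r / t) ^ 2 * (2 * (1 / (1 - ν)) ^ 2) ^ (i + 1) * z i *
        (4 ^ (i + 1) * z i) ^ α := by
      simp only [hz] at h1 ⊢
      rw [div_le_iff₀ (by positivity)]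
      refine h1.trans (le_of_eq ?_)
      field_simp
    refine h5.trans ((mul_le_mul_of_nonneg_left h3 ?_).trans (le_of_eq ?_))
    · have := hz0 i
      positivity
    · have : D ^ (i + 1) = (2 * (1 / (1 - ν)) ^ 2) ^ (i + 1) * 4 ^ (i + 1) := by
        rw [← mul_pow, hD, stepRatio]; ring_nf
      linear_combination (-(A₀ * (r / t) ^ 2 * (z i * z i ^ α))) * this
  have hρ0 : 0 < r / t := by linarith
  have hinit : (A₀ * (r / t) ^ 2 * D) * z 0 ^ α ≤ θ := by
    have hbc : 0 < boundConst σ ν k K Cs Cψ := Real.rpow_pos_of_pos (by positivity) _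
    set c := boundConst σ ν k K Cs Cψ with hcdef
    -- `boundConst` is the solution of this equation, which turns the assumed lower bound on `M`
    -- into the smallness of `z 0`.
    have hc2 : (c ^ 2) ^ α = A₀ * D / θ := by
      rw [hcdef, boundConst, ← Real.rpow_natCast, ← Real.rpow_mul (by positivity),
        ← Real.rpow_mul (by positivity), ← hα]
      rw [show 1 / (2 * α) * (((2 : ℕ) : ℝ) * α) = 1 by push_cast; field_simp, Real.rpow_one]
    have hρ2 : (((r / t) ^ (1 / α)) ^ 2) ^ α = (r / t) ^ 2 := by
      rw [← Real.rpow_natCast, ← Real.rpow_mul hρ0.le, ← Real.rpow_mul hρ0.le,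
        ← Real.rpow_natCast]
      congr 1
      field_simp
    rw [hαinv] at hAM
    set q := (r / t) ^ (1 / α) with hq
    have hq0 : 0 < q := Real.rpow_pos_of_pos hρ0 _
    have hz0A : z 0 ≤ 1 / (c ^ 2 * q ^ 2) := by
      have h1 : (X 0).toReal ≤ A ^ 2 := ENNReal.toReal_le_of_le_ofReal (sq_nonneg _) (hXA 0)
      rw [hz]
      simp only
      rw [div_le_div_iff₀ (by positivity) (by positivity), one_mul]
      calc (X 0).toReal * (c ^ 2 * q ^ 2) ≤ A ^ 2 * (c ^ 2 * q ^ 2) := by gcongr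
        _ = (c * q * A) ^ 2 := by ring
        _ ≤ M ^ 2 := pow_le_pow_left₀ (by positivity) hAM 2
    have h2 : z 0 ^ α ≤ 1 / (A₀ * D / θ * (r / t) ^ 2) := by
      refine (Real.rpow_le_rpow (hz0 0) hz0A hα0.le).trans (le_of_eq ?_)
      rw [Real.div_rpow zero_le_one (by positivity), Real.one_rpow,
        Real.mul_rpow (by positivity) (by positivity), hc2, hρ2]
    refine (mul_le_mul_of_nonneg_left h2 (by positivity)).trans (le_of_eq ?_)
    have := hr.1.ne'
    field_simp
  have hdecay := geometric_decay hα0 hD0.le (by positivity) hθ0.le hz0 hzstep hDθ.le hinit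
  have hθ1 : θ < 1 := by
    have hD1' : 1 < D := by rw [hD]; unfold stepRatio; nlinarith
    exact Real.rpow_lt_one_of_one_lt_of_neg hD1' (neg_neg_of_pos (by positivity))
  -- The inner ball lies in every support and `M` is above every level, so this quantity is bounded
  -- by each `X i`, which tends to 0.
  have hzero : levelMass u (mball Ω d y (ν * r)) M = 0 := by
    have hle : ∀ i, (volume B)⁻¹ * levelMass u (mball Ω d y (ν * r)) M ≤
        ENNReal.ofReal (θ ^ i * z 0 * M ^ 2) := fun i => by
      calc _ ≤ X i := mul_le_mul_right
            (levelMass_mono (hψ.mball_subset_tsupport (by omega)) (hκM i)) _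
        _ = ENNReal.ofReal (X i).toReal := (ENNReal.ofReal_toReal (hXt i)).symm
        _ ≤ _ := ENNReal.ofReal_le_ofReal ((div_le_iff₀ (by positivity)).1 (hdecay i))
    have hlim : Tendsto (fun i : ℕ => ENNReal.ofReal (θ ^ i * z 0 * M ^ 2)) atTop (𝓝 0) := by
      have := ENNReal.tendsto_ofReal
        (((tendsto_pow_atTop_nhds_zero_of_lt_one hθ0.le hθ1).mul_const (z 0)).mul_const (M ^ 2))
      simpa using this
    have h1 := le_antisymm (ge_of_tendsto' hlim hle) zero_le
    exact (mul_eq_zero.1 h1).resolve_left (ENNReal.inv_ne_zero.2 hbt)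
  have hum : AEMeasurable u (volume.restrict (mball Ω d y (ν * r))) :=
    hsol.memW.memLp.1.aemeasurable.mono_measure (Measure.restrict_mono mball_subset le_rfl)
  rw [levelMass, lintegral_eq_zero_iff'
    ((((hum.sub_const M).max aemeasurable_const).pow_const 2).ennreal_ofReal)] at hzero
  filter_upwards [hzero] with x hx
  have h1 : max (u x - M) 0 ^ 2 ≤ 0 := ENNReal.ofReal_eq_zero.1 hx
  have h2 : max (u x - M) 0 = 0 := pow_eq_zero_iff two_ne_zero |>.1 (le_antisymm h1 (sq_nonneg _))
  linarith [max_eq_right_iff.1 h2]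

end LocalBound

/-! ### Solutions of the quasilinear equation -/

section Quasilinear

variable {n : ℕ} {Ω : Set (E n)} {Q : E n → Matrix (Fin n) (Fin n) ℝ}
  {A : E n → ℝ → Matrix (Fin n) (Fin n) ℝ} {k K : ℝ} {f u : E n → ℝ} {v : E n → E n}

/-- The exceptional null set does not depend on `z`, so `z = u x` may be substituted pointwise. For
measurability, `u` is first replaced by a measurable representative. -/
lemma IsWeakSolution.isLinearSolution (hA : IsStructured Ω Q k K A)
    (h : IsWeakSolution Ω Q A f u v) :
    IsLinearSolution Ω Q k K (fun x => A x (u x)) f u v := by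
  refine ⟨h.memW, fun i j => ?_, hA.posSemidef.mono fun x hx => hx _,
    hA.bounds.mono fun x hx => hx _, h.equation⟩
  have hu := h.memW.memLp.1.aemeasurable
  refine (hA.aemeasurable (hu.mk u) hu.measurable_mk i j).congr ?_
  filter_upwards [hu.ae_eq_mk] with x hx
  rw [hx]

lemma MemW.neg (h : MemW Ω Q u v) : MemW Ω Q (fun x => -u x) (fun x => -v x) := by
  obtain ⟨wk, h1, h2, h3⟩ := h.exists_seq
  refine ⟨MemLp.neg h.memLp, h.aemeasurable.neg, ?_, fun k x => -wk k x, fun k => ?_, ?_, ?_⟩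
  · have := h.energy_lt_top
    simpa only [energy, form_neg_self] using this
  · obtain ⟨L, hL⟩ := h1 k
    exact ⟨L, hL.neg⟩
  · refine h2.congr fun k => ?_
    rw [← eLpNorm_neg]
    congr 1
    funext x
    simp only [Pi.neg_apply, Pi.sub_apply]
    ring
  · refine h3.congr fun k => lintegral_congr fun x => ?_
    have : gradient (fun x => -wk k x) x - -v x = -(gradient (wk k) x - v x) := by
      have h4 : gradient (fun x => -wk k x) x = -gradient (wk k) x := by
        rw [gradient, fderiv_fun_neg, map_neg, gradient]
      rw [h4]; abel
    beta_reduce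
    rw [this, form_neg_self]

/-- The coefficient matrix stays frozen at the original `u`, so the sign change affects only the
linear terms, and the same nonnegative test functions remain available. -/
lemma IsLinearSolution.neg {a : E n → Matrix (Fin n) (Fin n) ℝ}
    (h : IsLinearSolution Ω Q k K a f u v) :
    IsLinearSolution Ω Q k K a (fun x => -f x) (fun x => -u x) (fun x => -v x) := by
  refine ⟨h.memW.neg, h.aemeasurable, h.posSemidef, h.bounds, fun w g hw hw0 => ?_⟩
  have := h.equation w g hw hw0
  simp only [form_neg_left, neg_mul, integral_neg]
  rw [this]

end Quasilinear

/-! ### Local boundedness of weak solutions -/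

section Main

variable {n : ℕ} {Ω : Set (E n)} {Q : E n → Matrix (Fin n) (Fin n) ℝ}

lemma ofReal_setAverage_sq {B : Set (E n)} {u : E n → ℝ} (hu : MemLp u 2 (volume.restrict B))
    (h0 : volume B ≠ 0) (ht : volume B ≠ ∞) :
    (volume B)⁻¹ * ∫⁻ x in B, ENNReal.ofReal (u x ^ 2) = ENNReal.ofReal (⨍ x in B, u x ^ 2) := by
  have hpos : 0 < volume.real B := ENNReal.toReal_pos h0 ht
  rw [setAverage_eq, smul_eq_mul, ENNReal.ofReal_mul (inv_nonneg.2 hpos.le),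
    ENNReal.ofReal_inv_of_pos hpos, Measure.real, ENNReal.ofReal_toReal ht,
    ofReal_integral_eq_lintegral_ofReal hu.integrable_sq
      (Eventually.of_forall fun x => sq_nonneg _)]

lemma ae_abs_le_toReal_eLpNorm_top {μ : Measure (E n)} {f : E n → ℝ} (hf : MemLp f ∞ μ) :
    ∀ᵐ x ∂μ, |f x| ≤ (eLpNorm f ∞ μ).toReal := by
  filter_upwards [enorm_ae_le_eLpNormEssSup f μ] with x hx
  rw [← eLpNorm_exponent_top, Real.enorm_eq_ofReal_abs] at hx
  exact (ENNReal.ofReal_le_iff_le_toReal hf.2.ne).1 hx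

/-- The local bound for weak solutions. -/
lemma IsWeakSolution.eLpNorm_top_le {A : E n → ℝ → Matrix (Fin n) (Fin n) ℝ} {d : E n → E n → ℝ}
    {δ : E n → ℝ → ℝ} {η σ ν k K Cs Cψ : ℝ} {f u : E n → ℝ} {v : E n → E n}
    (hσ : 1 < σ) (hν : 0 < ν) (hν1 : ν < 1) (hk : 0 < k) (hkK : k ≤ K) (hCs : 0 < Cs)
    (hCψ : 0 < Cψ) (hΩ : IsOpen Ω) (hb : Bornology.IsBounded Ω) (hd : IsMetricOn Ω d)
    (hQ : IsWeight Ω Q) (hA : IsStructured Ω Q k K A) (hδ : IsNonDoublingOrder Ω d η δ)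
    (hc : Containment Ω d) (hS : WeakSobolev Ω d Q η σ Cs) (hψ : HasCutoffs Ω d Q δ η ν Cψ)
    (hf : MemLp f ∞ (volume.restrict Ω)) (hsol : IsWeakSolution Ω Q A f u v) {y : E n}
    (hy : y ∈ Ω) {r : ℝ} (hr : IsAdmissibleRadius Ω η y r) :
    eLpNorm u ∞ (volume.restrict (mball Ω d y (ν * r))) ≤
      ENNReal.ofReal (max 1 (boundConst σ ν k K Cs Cψ) * (r / δ y (ν * r)) ^ (σ / (σ - 1)) *
        ((⨍ x in mball Ω d y r, u x ^ 2) ^ (1 / 2 : ℝ) +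
          r ^ 2 * (eLpNorm f ∞ (volume.restrict Ω)).toReal)) := by
  obtain ⟨ψ, hacc⟩ := hψ y hy r hr
  have hr0 := hr.1
  have hνr : IsAdmissibleRadius Ω η y (ν * r) :=
    ⟨mul_pos hν hr0, (mul_le_of_le_one_left hr0.le hν1.le).trans_lt hr.2⟩
  obtain ⟨_, -, hδy⟩ := hδ y hy
  obtain ⟨hδ0, hδr, -, -⟩ := hδy _ hνr
  set B := mball Ω d y r with hBdef
  have hB : IsOpen B := isOpen_mball hd hc hy r
  have hb0 : volume B ≠ 0 := (hB.measure_pos volume ⟨y, mem_mball_self hd hy hr.1⟩).ne'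
  have hbt : volume B ≠ ∞ := (hb.subset mball_subset).measure_lt_top.ne
  set F := (eLpNorm f ∞ (volume.restrict Ω)).toReal with hFdef
  have hF : 0 ≤ F := ENNReal.toReal_nonneg
  have hfF := ae_abs_le_toReal_eLpNorm_top hf
  have hfm := hf.1.aemeasurable
  have havg : 0 ≤ ⨍ x in B, u x ^ 2 := by
    rw [setAverage_eq]
    exact smul_nonneg (inv_nonneg.2 measureReal_nonneg) (integral_nonneg fun x => sq_nonneg _)
  set a := (⨍ x in B, u x ^ 2) ^ (1 / 2 : ℝ) with ha
  have ha0 : 0 ≤ a := Real.rpow_nonneg havg _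
  have ha2 : a ^ 2 = ⨍ x in B, u x ^ 2 := by
    rw [ha, ← Real.rpow_natCast, ← Real.rpow_mul havg]; norm_num
  have huB : MemLp u 2 (volume.restrict B) :=
    hsol.memW.memLp.mono_measure (Measure.restrict_mono mball_subset le_rfl)
  have hAu : (volume B)⁻¹ * ∫⁻ x in B, ENNReal.ofReal (u x ^ 2) ≤ ENNReal.ofReal (a ^ 2) := by
    rw [ofReal_setAverage_sq huB hb0 hbt, ha2]
  set q := (r / δ y (ν * r)) ^ (σ / (σ - 1)) with hq
  have hρ : 1 ≤ r / δ y (ν * r) := by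
    rw [one_le_div hδ0]; exact hδr.trans (mul_le_of_le_one_left hr0.le hν1.le)
  have hq1 : 1 ≤ q := Real.one_le_rpow hρ (div_nonneg (by linarith) (by linarith))
  set c := boundConst σ ν k K Cs Cψ with hcdef
  have hc1 : 1 ≤ max 1 c := le_max_left _ _
  have hlin := hsol.isLinearSolution hA
  -- The iteration needs `M > 0`, which the bound itself does not give when the mean of `u` and the
  -- norm of `f` vanish; hence the added `ε`. The maximum with 1 ensures `r² F ≤ M`.
  have hbound : ∀ ε : ℝ, 0 < ε → eLpNorm u ∞ (volume.restrict (mball Ω d y (ν * r))) ≤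
      ENNReal.ofReal (max 1 c * q * (a + r ^ 2 * F) + ε) := by
    intro ε hε
    have h1 : 1 ≤ max 1 c * q := one_le_mul_of_one_le_of_one_le hc1 hq1
    have hrF : 0 ≤ r ^ 2 * F := by positivity
    have hM : 0 < max 1 c * q * (a + r ^ 2 * F) + ε := by positivity
    have hFM : r ^ 2 * F ≤ max 1 c * q * (a + r ^ 2 * F) + ε := by nlinarith
    have hAM : c * q * a ≤ max 1 c * q * (a + r ^ 2 * F) + ε := by
      have h2 : c * q * a ≤ max 1 c * q * a := by
        gcongr
        exact le_max_right _ _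
      nlinarith
    have hup := hlin.ae_le hσ hν hν1 hk hkK hCs hCψ hΩ hb hd hc hQ hS hF hfF hfm hy hr hacc hδ0
      hδr ha0 hAu hM hFM hAM
    have hlow := hlin.neg.ae_le hσ hν hν1 hk hkK hCs hCψ hΩ hb hd hc hQ hS hF
      (by simpa only [abs_neg] using hfF) hfm.neg hy hr hacc hδ0
      hδr ha0 (by simpa only [neg_sq] using hAu) hM hFM hAM
    rw [eLpNorm_exponent_top]
    refine eLpNormEssSup_le_of_ae_bound ?_
    filter_upwards [hup, hlow] with x h2 h3
    rw [Real.norm_eq_abs]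
    exact abs_le.2 ⟨by linarith, h2⟩
  have hlim : Tendsto (fun ε : ℝ => ENNReal.ofReal (max 1 c * q * (a + r ^ 2 * F) + ε)) (𝓝[>] 0)
      (𝓝 (ENNReal.ofReal (max 1 c * q * (a + r ^ 2 * F) + 0))) :=
    ENNReal.tendsto_ofReal ((tendsto_id.mono_left nhdsWithin_le_nhds).const_add _)
  rw [add_zero] at hlim
  exact ge_of_tendsto hlim (eventually_mem_nhdsWithin.mono fun ε hε => hbound ε hε)

/-- A bounded nonempty set is not the whole space in positive dimension, so its frontier is
nonempty. This matters because the distance to an empty set is 0 by convention. -/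
lemma infDist_frontier_pos (hn : n ≠ 0) (hΩ : IsOpen Ω) (hb : Bornology.IsBounded Ω) {y : E n}
    (hy : y ∈ Ω) : 0 < Metric.infDist y (frontier Ω) := by
  have : Nonempty (Fin n) := ⟨⟨0, Nat.pos_of_ne_zero hn⟩⟩
  have hne : (frontier Ω).Nonempty := by
    refine nonempty_frontier_iff.2 ⟨⟨y, hy⟩, fun h => ?_⟩
    exact NormedSpace.unbounded_univ ℝ (E n) (h ▸ hb)
  refine (isClosed_frontier.notMem_iff_infDist_pos hne).1 fun h => ?_
  rw [hΩ.frontier_eq] at h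
  exact h.2 hy

lemma exists_ae_abs_le_of_isCompact {u : E n → ℝ} {S : Set (E n)} (hS : IsCompact S)
    (h : ∀ y ∈ S, ∃ t ∈ 𝓝 y, eLpNorm u ∞ (volume.restrict t) < ∞) :
    ∃ c : ℝ, ∀ᵐ x ∂(volume.restrict S), |u x| ≤ c := by
  refine hS.induction_on (p := fun S => ∃ c : ℝ, ∀ᵐ x ∂(volume.restrict S), |u x| ≤ c)
    ⟨0, by simp⟩ ?_ ?_ ?_
  · rintro s t hst ⟨c, hc⟩
    exact ⟨c, ae_restrict_of_ae_restrict_of_subset hst hc⟩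
  · rintro s t ⟨c, hc⟩ ⟨c', hc'⟩
    refine ⟨max c c', (ae_restrict_union_iff _ _ _).2 ⟨?_, ?_⟩⟩
    · exact hc.mono fun x hx => hx.trans (le_max_left _ _)
    · exact hc'.mono fun x hx => hx.trans (le_max_right _ _)
  · intro y hy
    obtain ⟨t, ht, hlt⟩ := h y hy
    refine ⟨t, mem_nhdsWithin_of_mem_nhds ht, (eLpNorm u ∞ (volume.restrict t)).toReal, ?_⟩
    filter_upwards [enorm_ae_le_eLpNormEssSup u (volume.restrict t)] with x hx
    rw [← eLpNorm_exponent_top, Real.enorm_eq_ofReal_abs] at hx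
    exact (ENNReal.ofReal_le_iff_le_toReal hlt.ne).1 hx

end Main

end DegenerateEq

open DegenerateEq
theorem mainTheorem5 (σ ν k K Cs Cψ : ℝ) (hσ : 1 < σ) (hν : 0 < ν) (hν1 : ν < 1)
    (hk : 0 < k) (hkK : k ≤ K) (hCs : 0 < Cs) (hCψ : 0 < Cψ) :
    ∃ C : ℝ, 0 < C ∧
      ∀ (n : ℕ) (Ω : Set (EuclideanSpace ℝ (Fin n)))
        (d : EuclideanSpace ℝ (Fin n) → EuclideanSpace ℝ (Fin n) → ℝ)
        (Q : EuclideanSpace ℝ (Fin n) → Matrix (Fin n) (Fin n) ℝ)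
        (A : EuclideanSpace ℝ (Fin n) → ℝ → Matrix (Fin n) (Fin n) ℝ)
        (δ : EuclideanSpace ℝ (Fin n) → ℝ → ℝ) (η : ℝ)
        (f u : EuclideanSpace ℝ (Fin n) → ℝ)
        (v : EuclideanSpace ℝ (Fin n) → EuclideanSpace ℝ (Fin n)),
        IsOpen Ω → Bornology.IsBounded Ω →
        IsMetricOn Ω d → IsWeight Ω Q → IsStructured Ω Q k K A →
        0 < η → IsNonDoublingOrder Ω d η δ →
        Containment Ω d → WeakSobolev Ω d Q η σ Cs → HasCutoffs Ω d Q δ η ν Cψ →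
        MemLp f ∞ (volume.restrict Ω) → IsWeakSolution Ω Q A f u v →
        (∀ S : Set (EuclideanSpace ℝ (Fin n)), IsCompact S → S ⊆ Ω →
          MemLp u ∞ (volume.restrict S)) ∧
        ∀ y ∈ Ω, ∀ r : ℝ, 0 < r → r < η * Metric.infDist y (frontier Ω) →
          eLpNorm u ∞ (volume.restrict (mball Ω d y (ν * r))) ≤
            ENNReal.ofReal (C * (r / δ y (ν * r)) ^ (σ / (σ - 1)) *
              ((⨍ x in mball Ω d y r, u x ^ 2) ^ (1 / 2 : ℝ) +
                r ^ 2 * (eLpNorm f ∞ (volume.restrict Ω)).toReal)) := by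
  refine ⟨max 1 (boundConst σ ν k K Cs Cψ), lt_max_of_lt_left one_pos, ?_⟩
  intro n Ω d Q A δ η f u v hΩ hb hd hQ hA hη hδ hc hS hψ hf hsol
  have hloc : ∀ y ∈ Ω, ∀ r : ℝ, IsAdmissibleRadius Ω η y r → _ := fun y hy r hr =>
    hsol.eLpNorm_top_le hσ hν hν1 hk hkK hCs hCψ hΩ hb hd hQ hA hδ hc hS hψ hf hy hr
  refine ⟨fun S hS hSΩ => ?_, fun y hy r hr hr' => hloc y hy r ⟨hr, hr'⟩⟩
  have hum : AEStronglyMeasurable u (volume.restrict S) :=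
    hsol.memW.memLp.1.mono_measure (Measure.restrict_mono hSΩ le_rfl)
  suffices h : ∃ c : ℝ, ∀ᵐ x ∂(volume.restrict S), |u x| ≤ c by
    obtain ⟨c, hc⟩ := h
    exact memLp_top_of_bound hum c hc
  -- In dimension zero the frontier is empty and no radius is admissible, but the space is a single
  -- point.
  rcases eq_or_ne n 0 with rfl | hn
  · exact ⟨|u 0|, Eventually.of_forall fun x => by rw [Subsingleton.elim x 0]⟩
  refine exists_ae_abs_le_of_isCompact hS fun y hy => ?_
  have hdist := infDist_frontier_pos hn hΩ hb (hSΩ hy)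
  -- Half of the largest allowed radius is admissible, and the concentric ball scaled by `ν` is an
  -- open neighbourhood on which `u` is essentially bounded.
  have hadm : IsAdmissibleRadius Ω η y (η * Metric.infDist y (frontier Ω) / 2) :=
    ⟨by positivity, half_lt_self (by positivity)⟩
  exact ⟨_, (isOpen_mball hd hc (hSΩ hy) _).mem_nhds
    (mem_mball_self hd (hSΩ hy) (mul_pos hν hadm.1)),
    (hloc y (hSΩ hy) _ hadm).trans_lt ENNReal.ofReal_lt_top⟩
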